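/- Let $n\ge 3$, let $(\mathcal N,g_{\mathcal N})$ be a compact smooth Riemannian manifold (without boundary) of dimension $n-1$, let $r_H\ge 0$, and let $h:(0,\infty)\to\mathbb R$ be a smooth function that is positive on $(r_H,\infty)$, with $h(r_H)=0$ if $r_H>0$. Let $(\mathfrak M,\mathfrak g)$ be the spacetime of Class $\mathfrak H$ given by $$\mathfrak M=\mathbb R\times(r_H,\infty)\times\mathcal N,\qquad \mathfrak g=-h(r)\,dt^2+\tfrac1{h(r)}\,dr^2+r^2g_{\mathcal N},$$ and assume that it satisfies the null energy condition: $\mathfrak{Ric}(L,L)\ge 0$ for every null vector $L$. Let $r_H\le r_1<r_2\le\infty$, let $T:(r_1,r_2)\to\mathbb R$ be smooth, and suppose that the warped product graph $$M_T=\{(T(s),s,p): s\in(r_1,r_2),\ p\in\mathcal N\}$$ is spacelike, i.e. that the metric $g^T$ induced on it by $\mathfrak g$ is positive definite. Put $$h_T=\frac{h}{1-h\cdot h\,(T')^2},\qquad f_T=\sqrt{h_T},$$ so that $g^T=\frac1{h_T(s)}ds^2+s^2g_{\mathcal N}$, and let $\mathrm{Ric}^T$, $\mathrm{Hess}_T$,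 $\Delta_T$ be the Ricci curvature, Hessian and Laplacian of $g^T$. Let $$B^T=\Big(\tfrac12(h_T-h)''+\tfrac{n-3}{2s}(h_T-h)'-\tfrac{n-2}{s^2}(h_T-h)\Big)\,s^2g_{\mathcal N}.$$ Then: 1. For every $g^T$-unit vector $V$ tangent to $M_T$, $$B^T(V,V)\le \frac{\Delta_Tf_T}{f_T}-\frac{\mathrm{Hess}_Tf_T(V,V)}{f_T}+\mathrm{Ric}^T(V,V).$$ 2. Consequently, if $x=h_T-h$ is a nonnegative solution on $(r_1,r_2)$ of the ordinary differential inequality $$\tfrac12x''+\tfrac{n-3}{2s}x'-\tfrac{n-2}{s^2}x\ge 0,$$ then $(M_T,g^T)$ satisfies the substatic tensor inequality $$\frac{\Delta_Tf_T}{f_T}-\frac{\mathrm{Hess}_Tf_T(V,V)}{f_T}+\mathrm{Ric}^T(V,V)\ge 0$$ for every $g^T$-unit vector $V$ tangent to $M_T$. -/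

import Mathlib

open scoped Manifold ContDiff

set_option maxSynthPendingDepth 3

noncomputable section

namespace ClassH

/-! ### Curvature, Hessian and Laplacian of a pseudo-Riemannian metric

A metric on a manifold `M` is given by its bilinear forms `g x` on the tangent spaces. Curvature is
computed at a point `x` in the preferred chart at `x`, in coordinates with values in the model
vector space `E`; only the germ of the metric at `x` enters, so that `g` may be used on an open
subset of `M`. -/

section Curvature

variable {E : Type*} [NormedAddCommGroup E] [NormedSpace ℝ E]
  {H : Type*} [TopologicalSpace H] (I : ModelWithCorners ℝ E H)
  {M : Type*} [TopologicalSpace M] [ChartedSpace H M]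

/-- The pull back `(v, w) ↦ B (A v, A w)` of a bilinear form. -/
def pullForm {V W : Type*} [AddCommGroup V] [Module ℝ V] [TopologicalSpace V]
    [IsTopologicalAddGroup V] [ContinuousConstSMul ℝ V]
    [AddCommGroup W] [Module ℝ W] [TopologicalSpace W]
    [IsTopologicalAddGroup W] [ContinuousConstSMul ℝ W]
    (B : V →L[ℝ] V →L[ℝ] ℝ) (A : W →L[ℝ] V) : W →L[ℝ] W →L[ℝ] ℝ :=
  ((ContinuousLinearMap.precomp ℝ A).comp B).comp A

@[simp] theorem pullForm_apply {V W : Type*} [AddCommGroup V] [Module ℝ V] [TopologicalSpace V]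
    [IsTopologicalAddGroup V] [ContinuousConstSMul ℝ V]
    [AddCommGroup W] [Module ℝ W] [TopologicalSpace W]
    [IsTopologicalAddGroup W] [ContinuousConstSMul ℝ W]
    (B : V →L[ℝ] V →L[ℝ] ℝ) (A : W →L[ℝ] V) (v w : W) : pullForm B A v w = B (A v) (A w) := rfl

/-- The coordinate expression of `g` in the chart at `x₀`: the pull back of `g` under the
inverse of this chart. -/
def chartMetric (g : ∀ x : M, TangentSpace I x →L[ℝ] TangentSpace I x →L[ℝ] ℝ) (x₀ : M)
    (y : E) : E →L[ℝ] E →L[ℝ] ℝ :=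
  pullForm (V := TangentSpace I ((extChartAt I x₀).symm y)) (W := E)
    (g ((extChartAt I x₀).symm y)) (mfderiv 𝓘(ℝ, E) I (extChartAt I x₀).symm y)

/-- The coordinates, in the chart at `x`, of a tangent vector at `x`. -/
def coordVec (x : M) (v : TangentSpace I x) : E :=
  mfderiv I 𝓘(ℝ, E) (extChartAt I x) x v

/-- Christoffel symbols of the first kind of `G`:
`(u, v, w) ↦ 1/2 (∂ᵤ G(v, w) + ∂ᵥ G(u, w) - ∂_w G(u, v))` at `y`. -/
def christoffelFirst (G : E → E →L[ℝ] E →L[ℝ] ℝ) (y : E) : E →L[ℝ] E →L[ℝ] E →L[ℝ] ℝ :=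
  (1 / 2 : ℝ) • (fderiv ℝ G y + (fderiv ℝ G y).flip
    - ((ContinuousLinearMap.flipₗᵢ ℝ E E ℝ).toContinuousLinearEquiv :
        (E →L[ℝ] E →L[ℝ] ℝ) →L[ℝ] E →L[ℝ] E →L[ℝ] ℝ).comp (fderiv ℝ G y).flip)

theorem christoffelFirst_apply (G : E → E →L[ℝ] E →L[ℝ] ℝ) (y u v w : E) :
    christoffelFirst G y u v w =
      1 / 2 * (fderiv ℝ G y u v w + fderiv ℝ G y v u w - fderiv ℝ G y w u v) := rfl

/-- Christoffel symbols of the Levi-Civita connection of `G` (the index is raised with `G⁻¹`):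
`∇ᵤ v = ∂ᵤ v + Γ(u, v)`. -/
def christoffel (G : E → E →L[ℝ] E →L[ℝ] ℝ) (y : E) : E →L[ℝ] E →L[ℝ] E :=
  (ContinuousLinearMap.compL ℝ E (E →L[ℝ] ℝ) E (G y).inverse).comp (christoffelFirst G y)

/-- The endomorphism `u ↦ R(u, v) w` for the Riemann tensor
`R(u, v) w = ∇ᵤ ∇ᵥ w - ∇ᵥ ∇ᵤ w - ∇_[u, v] w`. -/
def curvatureEnd (G : E → E →L[ℝ] E →L[ℝ] ℝ) (y v w : E) : E →ₗ[ℝ] E where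
  toFun u := fderiv ℝ (christoffel G) y u v w - fderiv ℝ (christoffel G) y v u w
    + christoffel G y u (christoffel G y v w) - christoffel G y v (christoffel G y u w)
  map_add' u u' := by simp only [map_add, add_apply]; abel
  map_smul' c u := by
    simp only [map_smul, smul_apply, RingHom.id_apply, smul_sub, smul_add]

/-- Ricci curvature of `g` at `x`: the trace of `u ↦ R(u, v) w`. -/
def ricci (g : ∀ x : M, TangentSpace I x →L[ℝ] TangentSpace I x →L[ℝ] ℝ) (x : M)
    (v w : TangentSpace I x) : ℝ :=
  LinearMap.trace ℝ E
    (curvatureEnd (chartMetric I g x) (extChartAt I x x) (coordVec I x v) (coordVec I x w))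

/-- The Hessian `∂²f(u, v) - ∂f(Γ(u, v))` of `f` with respect to `g` at `x`, as a bilinear form in
the coordinates of the chart at `x`. -/
def chartHessian (g : ∀ x : M, TangentSpace I x →L[ℝ] TangentSpace I x →L[ℝ] ℝ) (f : M → ℝ)
    (x : M) : E →L[ℝ] E →L[ℝ] ℝ :=
  fderiv ℝ (fderiv ℝ (f ∘ (extChartAt I x).symm)) (extChartAt I x x)
    - (ContinuousLinearMap.compL ℝ E E ℝ
        (fderiv ℝ (f ∘ (extChartAt I x).symm) (extChartAt I x x))).comp
          (christoffel (chartMetric I g x) (extChartAt I x x))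

/-- The Hessian of `f` with respect to `g` at `x`. -/
def hessian (g : ∀ x : M, TangentSpace I x →L[ℝ] TangentSpace I x →L[ℝ] ℝ) (f : M → ℝ) (x : M)
    (v w : TangentSpace I x) : ℝ :=
  chartHessian I g f x (coordVec I x v) (coordVec I x w)

/-- The Laplacian of `f` with respect to `g` at `x`: the trace with respect to `g` of the
Hessian. -/
def laplacian (g : ∀ x : M, TangentSpace I x →L[ℝ] TangentSpace I x →L[ℝ] ℝ) (f : M → ℝ)
    (x : M) : ℝ :=
  LinearMap.trace ℝ E ((chartMetric I g x (extChartAt I x x)).inverse.comp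
    (chartHessian I g f x) : E →L[ℝ] E)

/-- The null energy condition on the region `U`: `Ric(L, L) ≥ 0` for all null vectors `L`. -/
def NullEnergyCondition (g : ∀ x : M, TangentSpace I x →L[ℝ] TangentSpace I x →L[ℝ] ℝ)
    (U : Set M) : Prop :=
  ∀ x ∈ U, ∀ L : TangentSpace I x, g x L L = 0 → 0 ≤ ricci I g x L L

end Curvature

/-! ### The spacetimes and their warped product graphs -/

/-- `h : (0, ∞) → ℝ` is smooth, positive on `(r_H, ∞)` with `r_H ≥ 0`, and `h(r_H) = 0` if
`r_H > 0`. -/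
structure IsMetricCoefficient (rH : ℝ) (h : ℝ → ℝ) : Prop where
  nonneg : 0 ≤ rH
  smooth : ContDiffOn ℝ ∞ h (Set.Ioi 0)
  pos : ∀ r, rH < r → 0 < h r
  zero : 0 < rH → h rH = 0

section Spacetime

variable {E : Type*} [NormedAddCommGroup E] [NormedSpace ℝ E]
  {N : Type*} [TopologicalSpace N] [ChartedSpace E N] [IsManifold 𝓘(ℝ, E) ∞ N]

/-- The model of the spacetime, an open subset of `ℝ × ℝ × N` with points `(t, r, p)`. -/
abbrev spacetimeModel (E : Type*) [NormedAddCommGroup E] [NormedSpace ℝ E] :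
    ModelWithCorners ℝ (ℝ × ℝ × E) (ModelProd ℝ (ModelProd ℝ E)) :=
  𝓘(ℝ, ℝ).prod (𝓘(ℝ, ℝ).prod 𝓘(ℝ, E))

/-- The model of a slice, an open subset of `ℝ × N` with points `(s, p)`. -/
abbrev sliceModel (E : Type*) [NormedAddCommGroup E] [NormedSpace ℝ E] :
    ModelWithCorners ℝ (ℝ × E) (ModelProd ℝ E) :=
  𝓘(ℝ, ℝ).prod 𝓘(ℝ, E)

/-- The region `ℝ × (r_H, ∞) × N`. -/
def spacetimeRegion (N : Type*) (rH : ℝ) : Set (ℝ × ℝ × N) := {x | rH < x.2.1}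

/-- `-h(r) dt² + dr² / h(r) + r² g_N` on `ℝ × ℝ × N`. -/
def spacetimeMetric (h : ℝ → ℝ)
    (gN : Bundle.ContMDiffRiemannianMetric 𝓘(ℝ, E) ∞ E (TangentSpace 𝓘(ℝ, E) : N → Type _))
    (x : ℝ × ℝ × N) :
    TangentSpace (spacetimeModel E) x →L[ℝ] TangentSpace (spacetimeModel E) x →L[ℝ] ℝ :=
  let dt : TangentSpace (spacetimeModel E) x →L[ℝ] ℝ :=
    mfderiv (spacetimeModel E) 𝓘(ℝ, ℝ) (fun q : ℝ × ℝ × N => q.1) x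
  let dr : TangentSpace (spacetimeModel E) x →L[ℝ] ℝ :=
    mfderiv (spacetimeModel E) 𝓘(ℝ, ℝ) (fun q : ℝ × ℝ × N => q.2.1) x
  let dp : TangentSpace (spacetimeModel E) x →L[ℝ] TangentSpace 𝓘(ℝ, E) x.2.2 :=
    mfderiv (spacetimeModel E) 𝓘(ℝ, E) (fun q : ℝ × ℝ × N => q.2.2) x;
  (-h x.2.1) • dt.smulRight dt + (1 / h x.2.1) • dr.smulRight dr
    + x.2.1 ^ 2 • pullForm (gN.inner x.2.2) dp

/-- The parametrization `(s, p) ↦ (T(s), s, p)` of the graph `M_T`. -/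
def graphMap (N : Type*) (T : ℝ → ℝ) (q : ℝ × N) : ℝ × ℝ × N := (T q.1, q.1, q.2)

/-- The metric `g^T` induced on the graph `M_T` by the spacetime metric. -/
def graphMetric (h : ℝ → ℝ)
    (gN : Bundle.ContMDiffRiemannianMetric 𝓘(ℝ, E) ∞ E (TangentSpace 𝓘(ℝ, E) : N → Type _))
    (T : ℝ → ℝ) (q : ℝ × N) :
    TangentSpace (sliceModel E) q →L[ℝ] TangentSpace (sliceModel E) q →L[ℝ] ℝ :=
  pullForm (spacetimeMetric h gN (graphMap N T q))
    (mfderiv (sliceModel E) (spacetimeModel E) (graphMap N T) q)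

/-- The interval `(r₁, r₂)`, where `r₂ = ∞` is allowed. -/
def radialInterval (r₁ : ℝ) (r₂ : EReal) : Set ℝ := {s | r₁ < s ∧ (s : EReal) < r₂}

/-- `T` is the radial height function on `(r₁, r₂) ⊆ (r_H, ∞)` of a spacelike warped product
graph. -/
structure IsWarpedProductGraph (rH : ℝ) (h : ℝ → ℝ)
    (gN : Bundle.ContMDiffRiemannianMetric 𝓘(ℝ, E) ∞ E (TangentSpace 𝓘(ℝ, E) : N → Type _))
    (T : ℝ → ℝ) (r₁ : ℝ) (r₂ : EReal) : Prop where
  le_left : rH ≤ r₁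
  lt : (r₁ : EReal) < r₂
  smooth : ContDiffOn ℝ ∞ T (radialInterval r₁ r₂)
  spacelike : ∀ s ∈ radialInterval r₁ r₂, ∀ (p : N) (v : TangentSpace (sliceModel E) (s, p)),
    v ≠ 0 → 0 < graphMetric h gN T (s, p) v v

/-- `h_T = h / (1 - h |∇₀T|²)` with `|∇₀T|² = h (T')²`; that is,
`g^T = ds² / h_T + s² g_N`. -/
def graphCoeff (h T : ℝ → ℝ) (s : ℝ) : ℝ := h s / (1 - h s * (h s * deriv T s ^ 2))

/-- `f_T = √h_T` as a function on the graph. -/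
def graphLapse (N : Type*) (h T : ℝ → ℝ) (q : ℝ × N) : ℝ := √(graphCoeff h T q.1)

/-- The expression `x''/2 + (n - 3) x' / (2 s) - (n - 2) x / s²`. -/
def odi (n : ℕ) (x : ℝ → ℝ) (s : ℝ) : ℝ :=
  1 / 2 * deriv (deriv x) s + ((n : ℝ) - 3) / (2 * s) * deriv x s - ((n : ℝ) - 2) / s ^ 2 * x s

/-- The tensor `B^T`: the expression above for `x = h_T - h`, times `s² g_N`. -/
def graphTensor (n : ℕ) (h : ℝ → ℝ)
    (gN : Bundle.ContMDiffRiemannianMetric 𝓘(ℝ, E) ∞ E (TangentSpace 𝓘(ℝ, E) : N → Type _))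
    (T : ℝ → ℝ) (q : ℝ × N) (v w : TangentSpace (sliceModel E) q) : ℝ :=
  odi n (fun s => graphCoeff h T s - h s) q.1 * (q.1 ^ 2 * gN.inner q.2
    (mfderiv (sliceModel E) 𝓘(ℝ, E) (fun q' : ℝ × N => q'.2) q v)
    (mfderiv (sliceModel E) 𝓘(ℝ, E) (fun q' : ℝ × N => q'.2) q w))

end Spacetime

end ClassH

end

open ClassH

namespace ClassH

open Filter Topology

/-! ### Coordinate Levi-Civita calculus: traces, Christoffel symbols, smoothness -/

section General

/-! Both sides of the comparison have the same form. Let `φ = h_T`, `ψ = √φ`, and let `V` be a unit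
vector of `ds²/φ + s² G` with fibre component `e`. In the substatic expression of `ψ` the purely
radial contributions cancel, and what remains is `odi n φ · s² G(e, e) + Ric_G(e, e)`
(`substatic_sliceForm`). For a null vector `L = (a, 0, e)` of the spacetime at the same radius,
nullity forces `a² h = s² G(e, e)`, and then `Ric(L, L) = odi n h · s² G(e, e) + Ric_G(e, e)`
(`trace_curvatureEnd_spacetimeForm`).

Since `odi` is linear, subtraction gives substatic expression `- B^T(V, V) = Ric(L, L)`, which is
nonnegative by the null energy condition. The Ricci curvature of the fibre cancels, so no assumption
on it is needed. The second claim follows because `B^T` is then a nonnegative multiple of the fibre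
metric.

The two identities are proved for metrics on `ℝ × E` and `ℝ × ℝ × E`, then transferred to the
manifolds through product charts, where only the germ of the metric matters. -/

theorem trace_prod {V W : Type*} [AddCommGroup V] [Module ℝ V] [FiniteDimensional ℝ V]
    [AddCommGroup W] [Module ℝ W] [FiniteDimensional ℝ W] (L : V × W →ₗ[ℝ] V × W) :
    LinearMap.trace ℝ (V × W) L =
      LinearMap.trace ℝ V (LinearMap.fst ℝ V W ∘ₗ L ∘ₗ LinearMap.inl ℝ V W) +
      LinearMap.trace ℝ W (LinearMap.snd ℝ V W ∘ₗ L ∘ₗ LinearMap.inr ℝ V W) := by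
  -- Each summand factors through one projection, so cyclicity of the trace turns it into a trace
  -- over that factor.
  have hL : L = (L ∘ₗ LinearMap.inl ℝ V W) ∘ₗ LinearMap.fst ℝ V W +
      (L ∘ₗ LinearMap.inr ℝ V W) ∘ₗ LinearMap.snd ℝ V W := by
    ext x <;> simp [← Prod.zero_eq_mk]
  conv_lhs => rw [hL]
  rw [map_add, LinearMap.trace_comp_comm', LinearMap.trace_comp_comm' (L ∘ₗ LinearMap.inr ℝ V W)]

theorem trace_real (L : ℝ →ₗ[ℝ] ℝ) : LinearMap.trace ℝ ℝ L = L 1 := by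
  have hL : L = L 1 • LinearMap.id := by ext; simp
  conv_lhs => rw [hL]
  simp

theorem trace_toSpanSingleton {W : Type*} [AddCommGroup W] [Module ℝ W] [FiniteDimensional ℝ W]
    (l : W →ₗ[ℝ] ℝ) (e : W) :
    LinearMap.trace ℝ W (l.smulRight e) = l e := by
  simp

variable {E : Type*} [NormedAddCommGroup E] [NormedSpace ℝ E]

/-- Agreement is needed on a neighbourhood, not only at `y`, because curvature differentiates the
Christoffel symbols once more. -/
theorem christoffel_eventuallyEq {G G' : E → E →L[ℝ] E →L[ℝ] ℝ} {y : E} (hG : G =ᶠ[𝓝 y] G') :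
    christoffel G =ᶠ[𝓝 y] christoffel G' := by
  filter_upwards [hG.eventually_nhds] with z hz
  have hz' : G =ᶠ[𝓝 z] G' := hz
  unfold christoffel christoffelFirst
  rw [hz'.fderiv_eq, hz'.eq_of_nhds]

theorem curvatureEnd_congr {G G' : E → E →L[ℝ] E →L[ℝ] ℝ} {y : E} (hG : G =ᶠ[𝓝 y] G') (v w : E) :
    curvatureEnd G y v w = curvatureEnd G' y v w := by
  ext u
  simp only [curvatureEnd, LinearMap.coe_mk, AddHom.coe_mk]
  rw [(christoffel_eventuallyEq hG).fderiv_eq, (christoffel_eventuallyEq hG).eq_of_nhds]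

theorem christoffel_apply (G : E → E →L[ℝ] E →L[ℝ] ℝ) (y u v : E) :
    christoffel G y u v = (G y).inverse (christoffelFirst G y u v) := rfl

theorem metric_christoffel {G : E → E →L[ℝ] E →L[ℝ] ℝ} {y : E} (hG : (G y).IsInvertible)
    (u v w : E) : G y (christoffel G y u v) w =
      1 / 2 * (fderiv ℝ G y u v w + fderiv ℝ G y v u w - fderiv ℝ G y w u v) := by
  rw [christoffel_apply, hG.self_apply_inverse, christoffelFirst_apply]

/-- The Koszul formula determines the symbol by nondegeneracy, so an explicit candidate can be
verified without ever computing the inverse metric. -/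
theorem christoffel_eq_of_forall {G : E → E →L[ℝ] E →L[ℝ] ℝ} {y : E} (hG : (G y).IsInvertible)
    {u v z : E} (hz : ∀ w, G y z w =
      1 / 2 * (fderiv ℝ G y u v w + fderiv ℝ G y v u w - fderiv ℝ G y w u v)) :
    christoffel G y u v = z := by
  rw [christoffel_apply, hG.inverse_apply_eq]
  ext w
  rw [hz, christoffelFirst_apply]

/-- Nondegeneracy, rather than positivity, is what the Lorentzian metric also satisfies. -/
theorem isInvertible_of_nondegenerate [FiniteDimensional ℝ E] {B : E →L[ℝ] E →L[ℝ] ℝ}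
    (hB : ∀ v, (∀ w, B v w = 0) → v = 0) : B.IsInvertible := by
  have hinj : Function.Injective (B : E →ₗ[ℝ] E →L[ℝ] ℝ) := by
    rw [injective_iff_map_eq_zero]
    intro v hv
    exact hB v fun w => by
      have : B v = 0 := hv
      simp [this]
  have hdim : Module.finrank ℝ E = Module.finrank ℝ (E →L[ℝ] ℝ) := by
    rw [← (LinearMap.toContinuousLinearMap (𝕜 := ℝ) (E := E) (F' := ℝ)).finrank_eq]
    exact (Subspace.dual_finrank_eq (K := ℝ) (V := E)).symm
  refine ⟨(LinearEquiv.ofInjectiveOfFinrankEq (B : E →ₗ[ℝ] E →L[ℝ] ℝ) hinj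
    hdim).toContinuousLinearEquiv, ?_⟩
  ext v w
  rfl

theorem contDiffAt_christoffel [CompleteSpace E] {G : E → E →L[ℝ] E →L[ℝ] ℝ} {y : E}
    (hG : ContDiffAt ℝ ∞ G y) (hi : (G y).IsInvertible) : ContDiffAt ℝ ∞ (christoffel G) y := by
  have h1 : ContDiffAt ℝ ∞ (fderiv ℝ G) y := hG.fderiv_right (by simp)
  have h2 : ContDiffAt ℝ ∞ (fun z => (G z).inverse) y :=
    (hi.contDiffAt_map_inverse).comp y hG
  have h3 : ContDiffAt ℝ ∞ (fun z => (fderiv ℝ G z).flip) y :=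
    (ContinuousLinearMap.flipₗᵢ ℝ E E (E →L[ℝ] ℝ)).contDiff.contDiffAt.comp y h1
  have h4 : ContDiffAt ℝ ∞ (christoffelFirst G) y := by
    unfold christoffelFirst
    exact ((h1.add h3).sub (contDiffAt_const.clm_comp h3)).const_smul (1 / 2 : ℝ)
  unfold christoffel
  exact (((ContinuousLinearMap.compL ℝ E (E →L[ℝ] ℝ) E).contDiff.contDiffAt.comp y h2)).clm_comp h4

theorem differentiableAt_christoffel [CompleteSpace E] {G : E → E →L[ℝ] E →L[ℝ] ℝ} {y : E}
    (hG : ContDiffAt ℝ ∞ G y) (hi : (G y).IsInvertible) :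
    DifferentiableAt ℝ (christoffel G) y :=
  (contDiffAt_christoffel hG hi).differentiableAt (by simp)

/-- Reduces derivatives of operator-valued maps to derivatives of their values on fixed vectors,
where explicit formulas can be differentiated. -/
theorem fderiv_apply₂ {F F' F'' : Type*} [NormedAddCommGroup F] [NormedSpace ℝ F]
    [NormedAddCommGroup F'] [NormedSpace ℝ F'] [NormedAddCommGroup F''] [NormedSpace ℝ F'']
    {Γ : E → F →L[ℝ] F' →L[ℝ] F''} {y : E}
    (hΓ : DifferentiableAt ℝ Γ y) (u : E) (v : F) (w : F') :
    fderiv ℝ Γ y u v w = fderiv ℝ (fun z => Γ z v w) y u := by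
  rw [fderiv_clm_apply (hΓ.clm_apply (differentiableAt_const v)) (differentiableAt_const w),
    fderiv_clm_apply hΓ (differentiableAt_const v)]
  simp

theorem christoffel_symm {G : E → E →L[ℝ] E →L[ℝ] ℝ} {y : E} (hG : DifferentiableAt ℝ G y)
    (hs : ∀ᶠ z in 𝓝 y, ∀ v w, G z v w = G z w v) (u v : E) :
    christoffel G y u v = christoffel G y v u := by
  have key : ∀ a b c, fderiv ℝ G y a b c = fderiv ℝ G y a c b := by
    intro a b c
    rw [fderiv_apply₂ hG, fderiv_apply₂ hG]
    have : (fun z => G z b c) =ᶠ[𝓝 y] fun z => G z c b := by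
      filter_upwards [hs] with z hz using hz b c
    rw [this.fderiv_eq]
  rw [christoffel_apply, christoffel_apply]
  congr 1
  ext w
  rw [christoffelFirst_apply, christoffelFirst_apply, key w u v]
  ring

end General

/-! ### Christoffel symbols of `ds²/φ + s² G` -/

section Slice

variable {E : Type*} [NormedAddCommGroup E] [NormedSpace ℝ E]

/-- `G` is smooth at `y`, and symmetric and positive definite there. -/
structure RiemannianAt (G : E → E →L[ℝ] E →L[ℝ] ℝ) (y : E) : Prop where
  contDiffAt : ContDiffAt ℝ ∞ G y
  symm : ∀ v w, G y v w = G y w v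
  pos : ∀ v, v ≠ 0 → 0 < G y v v

/-- `φ` is smooth at `s` and positive there. -/
structure CoeffAt (φ : ℝ → ℝ) (s : ℝ) : Prop where
  contDiffAt : ContDiffAt ℝ ∞ φ s
  pos : 0 < φ s

theorem CoeffAt.hasDerivAt {φ : ℝ → ℝ} {s : ℝ} (h : CoeffAt φ s) :
    HasDerivAt φ (deriv φ s) s :=
  (h.contDiffAt.differentiableAt (by simp)).hasDerivAt

theorem CoeffAt.contDiffAt_deriv {φ : ℝ → ℝ} {s : ℝ} (h : CoeffAt φ s) :
    ContDiffAt ℝ ∞ (deriv φ) s := by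
  have : deriv φ = fun x => fderiv ℝ φ x 1 := by ext x; simp
  rw [this]
  exact (h.contDiffAt.fderiv_right (m := ∞) (by simp)).clm_apply contDiffAt_const

theorem CoeffAt.hasDerivAt_deriv {φ : ℝ → ℝ} {s : ℝ} (h : CoeffAt φ s) :
    HasDerivAt (deriv φ) (deriv (deriv φ) s) s :=
  (h.contDiffAt_deriv.differentiableAt (by simp)).hasDerivAt

theorem RiemannianAt.isInvertible [FiniteDimensional ℝ E] {G : E → E →L[ℝ] E →L[ℝ] ℝ} {y : E}
    (h : RiemannianAt G y) : (G y).IsInvertible :=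
  isInvertible_of_nondegenerate fun v hv => by
    by_contra hne
    exact (h.pos v hne).ne' (hv v)

theorem RiemannianAt.differentiableAt {G : E → E →L[ℝ] E →L[ℝ] ℝ} {y : E}
    (h : RiemannianAt G y) : DifferentiableAt ℝ G y :=
  h.contDiffAt.differentiableAt (by simp)

theorem RiemannianAt.differentiableAt_christoffel [FiniteDimensional ℝ E]
    {G : E → E →L[ℝ] E →L[ℝ] ℝ} {y : E}
    (h : RiemannianAt G y) : DifferentiableAt ℝ (christoffel G) y :=
  have := FiniteDimensional.complete ℝ E
  ClassH.differentiableAt_christoffel h.contDiffAt h.isInvertible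

/-- The metric `ds² / φ + s² G` in coordinates. -/
noncomputable def sliceForm (φ : ℝ → ℝ) (G : E → E →L[ℝ] E →L[ℝ] ℝ) (x : ℝ × E) :
    ℝ × E →L[ℝ] ℝ × E →L[ℝ] ℝ :=
  (1 / φ x.1) • (ContinuousLinearMap.fst ℝ ℝ E).smulRight (ContinuousLinearMap.fst ℝ ℝ E)
    + x.1 ^ 2 • pullForm (G x.2) (ContinuousLinearMap.snd ℝ ℝ E)

theorem sliceForm_apply (φ : ℝ → ℝ) (G : E → E →L[ℝ] E →L[ℝ] ℝ) (x v w : ℝ × E) :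
    sliceForm φ G x v w = 1 / φ x.1 * (v.1 * w.1) + x.1 ^ 2 * G x.2 v.2 w.2 := rfl

variable {φ : ℝ → ℝ} {G : E → E →L[ℝ] E →L[ℝ] ℝ} {x : ℝ × E}

theorem contDiffAt_pullForm {F F' : Type*} [NormedAddCommGroup F] [NormedSpace ℝ F]
    [NormedAddCommGroup F'] [NormedSpace ℝ F'] {B : F' → E →L[ℝ] E →L[ℝ] ℝ} {A : F' → F →L[ℝ] E}
    {z : F'} (hB : ContDiffAt ℝ ∞ B z) (hA : ContDiffAt ℝ ∞ A z) :
    ContDiffAt ℝ ∞ (fun z => pullForm (B z) (A z)) z := by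
  have h1 : ContDiffAt ℝ ∞ (fun z => ContinuousLinearMap.precomp ℝ (A z)) z :=
    ((ContinuousLinearMap.compL ℝ F E ℝ).flip.contDiff.contDiffAt).comp z hA
  exact (h1.clm_comp hB).clm_comp hA

theorem contDiffAt_sliceForm (hφ : CoeffAt φ x.1) (hG : RiemannianAt G x.2) :
    ContDiffAt ℝ ∞ (sliceForm φ G) x := by
  have h1 : ContDiffAt ℝ ∞ (fun z : ℝ × E => 1 / φ z.1) x :=
    contDiffAt_const.div (hφ.contDiffAt.comp x contDiffAt_fst) hφ.pos.ne'
  have h2 : ContDiffAt ℝ ∞ (fun z : ℝ × E => G z.2) x := hG.contDiffAt.comp x contDiffAt_snd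
  exact (h1.smul contDiffAt_const).add
    ((contDiffAt_fst.pow 2).smul (contDiffAt_pullForm h2 contDiffAt_const))

theorem RiemannianAt.sliceForm (hφ : CoeffAt φ x.1) (hG : RiemannianAt G x.2) (hx : 0 < x.1) :
    RiemannianAt (sliceForm φ G) x where
  contDiffAt := contDiffAt_sliceForm hφ hG
  symm v w := by rw [sliceForm_apply, sliceForm_apply, hG.symm]; ring
  pos v hv := by
    rw [sliceForm_apply]
    have hφ0 := hφ.pos
    by_cases h2 : v.2 = 0
    · have h1 : v.1 ≠ 0 := fun h1 => hv (Prod.ext h1 h2)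
      have : 0 < v.1 * v.1 := mul_self_pos.2 h1
      rw [h2]
      simp only [map_zero, mul_zero, add_zero]
      positivity
    · have := hG.pos _ h2
      have : 0 ≤ v.1 * v.1 := mul_self_nonneg _
      positivity

theorem hasFDerivAt_comp_fst {f : ℝ → ℝ} {f' : ℝ} (hf : HasDerivAt f f' x.1) :
    HasFDerivAt (fun z : ℝ × E => f z.1) (f' • ContinuousLinearMap.fst ℝ ℝ E) x :=
  hf.comp_hasFDerivAt x hasFDerivAt_fst

theorem hasFDerivAt_comp_snd {F : Type*} [NormedAddCommGroup F] [NormedSpace ℝ F]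
    {f : E → F} (hf : DifferentiableAt ℝ f x.2) :
    HasFDerivAt (fun z : ℝ × E => f z.2)
      ((fderiv ℝ f x.2).comp (ContinuousLinearMap.snd ℝ ℝ E)) x :=
  hf.hasFDerivAt.comp x hasFDerivAt_snd

theorem differentiableAt_apply₂ {F F' F'' : Type*} [NormedAddCommGroup F] [NormedSpace ℝ F]
    [NormedAddCommGroup F'] [NormedSpace ℝ F'] [NormedAddCommGroup F''] [NormedSpace ℝ F'']
    {Γ : E → F →L[ℝ] F' →L[ℝ] F''} {y : E} (hΓ : DifferentiableAt ℝ Γ y) (v : F) (w : F') :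
    DifferentiableAt ℝ (fun z => Γ z v w) y :=
  (hΓ.clm_apply (differentiableAt_const v)).clm_apply (differentiableAt_const w)

theorem fderiv_sliceForm (hφ : CoeffAt φ x.1) (hG : RiemannianAt G x.2) (u v w : ℝ × E) :
    fderiv ℝ (sliceForm φ G) x u v w =
      -(deriv φ x.1 / φ x.1 ^ 2) * u.1 * (v.1 * w.1) + 2 * x.1 * u.1 * G x.2 v.2 w.2
        + x.1 ^ 2 * fderiv ℝ G x.2 u.2 v.2 w.2 := by
  rw [fderiv_apply₂ ((contDiffAt_sliceForm hφ hG).differentiableAt (by simp))]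
  have h1 := (hasFDerivAt_comp_fst (E := E) (hφ.hasDerivAt.inv hφ.pos.ne')).mul_const (v.1 * w.1)
  have h2 := (hasFDerivAt_comp_fst (x := x) (hasDerivAt_pow 2 x.1)).mul
    (hasFDerivAt_comp_snd (differentiableAt_apply₂ hG.differentiableAt v.2 w.2))
  have h3 := (h1.add h2).fderiv
  have h4 : (fun z : ℝ × E => sliceForm φ G z v w) = fun z : ℝ × E =>
      (φ⁻¹ z.1) * (v.1 * w.1) + z.1 ^ 2 * G z.2 v.2 w.2 := by
    ext z; rw [sliceForm_apply]; simp
  rw [h4]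
  refine (DFunLike.congr_fun h3 u).trans ?_
  rw [fderiv_apply₂ hG.differentiableAt]
  simp
  ring

theorem christoffel_sliceForm [FiniteDimensional ℝ E] (hφ : CoeffAt φ x.1)
    (hG : RiemannianAt G x.2) (hx : 0 < x.1) (v w : ℝ × E) :
    christoffel (sliceForm φ G) x v w =
      (-(deriv φ x.1 / (2 * φ x.1)) * (v.1 * w.1) - φ x.1 * x.1 * G x.2 v.2 w.2,
        x.1⁻¹ • (v.1 • w.2 + w.1 • v.2) + christoffel G x.2 v.2 w.2) := by
  apply christoffel_eq_of_forall (hG.sliceForm hφ hx).isInvertible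
  intro z
  simp only [fderiv_sliceForm hφ hG, sliceForm_apply, map_add, map_smul, add_apply, smul_apply,
    metric_christoffel hG.isInvertible, smul_eq_mul]
  have := hφ.pos
  field_simp
  ring

theorem fderiv_christoffel_sliceForm [FiniteDimensional ℝ E] (hφ : ∀ᶠ s in 𝓝 x.1, CoeffAt φ s)
    (hG : ∀ᶠ y in 𝓝 x.2, RiemannianAt G y) (hx : 0 < x.1) (u v w : ℝ × E) :
    fderiv ℝ (christoffel (sliceForm φ G)) x u v w =
      (-(deriv (fun s => deriv φ s / (2 * φ s)) x.1) * u.1 * (v.1 * w.1)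
        - (deriv φ x.1 * x.1 + φ x.1) * u.1 * G x.2 v.2 w.2
        - φ x.1 * x.1 * fderiv ℝ G x.2 u.2 v.2 w.2,
        -(u.1 / x.1 ^ 2) • (v.1 • w.2 + w.1 • v.2) + fderiv ℝ (christoffel G) x.2 u.2 v.2 w.2) := by
  have hφ0 := hφ.self_of_nhds
  have hG0 := hG.self_of_nhds
  rw [fderiv_apply₂ (hG0.sliceForm hφ0 hx).differentiableAt_christoffel]
  have hev : (fun z => christoffel (sliceForm φ G) z v w) =ᶠ[𝓝 x] fun z =>
      (-(deriv φ z.1 / (2 * φ z.1)) * (v.1 * w.1) - φ z.1 * z.1 * G z.2 v.2 w.2,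
        z.1⁻¹ • (v.1 • w.2 + w.1 • v.2) + christoffel G z.2 v.2 w.2) := by
    filter_upwards [continuousAt_fst.eventually hφ, continuousAt_snd.eventually hG,
      continuousAt_fst.eventually (lt_mem_nhds hx)] with z h1 h2 h3
    exact christoffel_sliceForm h1 h2 h3 v w
  rw [hev.fderiv_eq]
  -- This derivative stays unevaluated: it cancels by antisymmetry when the curvature is formed.
  have hk : HasDerivAt (fun s => deriv φ s / (2 * φ s))
      (deriv (fun s => deriv φ s / (2 * φ s)) x.1) x.1 := by
    apply DifferentiableAt.hasDerivAt
    exact hφ0.hasDerivAt_deriv.differentiableAt.div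
      (hφ0.hasDerivAt.differentiableAt.const_mul 2) (mul_pos two_pos hφ0.pos).ne'
  have h1 := (hasFDerivAt_comp_fst (E := E) hk.neg).mul_const (v.1 * w.1)
  have h2 := (hasFDerivAt_comp_fst (E := E) (hφ0.hasDerivAt.mul (hasDerivAt_id x.1))).mul
    (hasFDerivAt_comp_snd (differentiableAt_apply₂ hG0.differentiableAt v.2 w.2))
  have h3 := (hasFDerivAt_comp_fst (E := E) (hasDerivAt_inv hx.ne')).smul_const
    (v.1 • w.2 + w.1 • v.2)
  have h4 := hasFDerivAt_comp_snd (x := x)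
    (differentiableAt_apply₂ hG0.differentiableAt_christoffel v.2 w.2)
  have h5 := ((h1.sub h2).prodMk (h3.add h4)).fderiv
  refine (DFunLike.congr_fun h5 u).trans ?_
  rw [fderiv_apply₂ hG0.differentiableAt, fderiv_apply₂ hG0.differentiableAt_christoffel]
  ext
  · simp
    ring
  · simp [smul_smul]
    ring_nf

end Slice

/-! ### Ricci curvature, Hessian and substatic expression of `ds²/φ + s² G` -/

section Slice

variable {E : Type*} [NormedAddCommGroup E] [NormedSpace ℝ E]

theorem curvatureEnd_apply (G : E → E →L[ℝ] E →L[ℝ] ℝ) (y v w u : E) :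
    curvatureEnd G y v w u =
      fderiv ℝ (christoffel G) y u v w - fderiv ℝ (christoffel G) y v u w
        + christoffel G y u (christoffel G y v w) - christoffel G y v (christoffel G y u w) := rfl

variable [FiniteDimensional ℝ E] {φ ψ : ℝ → ℝ} {G : E → E →L[ℝ] E →L[ℝ] ℝ} {x : ℝ × E}

omit [FiniteDimensional ℝ E] in
theorem christoffel_symm_of_riemannianAt (hG : ∀ᶠ y in 𝓝 x.2, RiemannianAt G y) (u v : E) :
    christoffel G x.2 u v = christoffel G x.2 v u :=
  christoffel_symm hG.self_of_nhds.differentiableAt (hG.mono fun _ hy => hy.symm) u v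

theorem curvatureEnd_sliceForm_fst (hφ : ∀ᶠ s in 𝓝 x.1, CoeffAt φ s)
    (hG : ∀ᶠ y in 𝓝 x.2, RiemannianAt G y) (hx : 0 < x.1) (V : ℝ × E) :
    (curvatureEnd (sliceForm φ G) x V V (1, 0)).1 =
      -(deriv φ x.1 * x.1 / 2) * G x.2 V.2 V.2 := by
  have hφ0 := hφ.self_of_nhds.pos
  rw [curvatureEnd_apply]
  simp only [fderiv_christoffel_sliceForm hφ hG hx,
    christoffel_sliceForm hφ.self_of_nhds hG.self_of_nhds hx, Prod.fst_add, Prod.fst_sub,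
    map_zero, zero_apply, map_add, map_smul, smul_zero, add_zero, smul_eq_mul, one_smul]
  field_simp
  ring

theorem curvatureEnd_sliceForm_snd (hφ : ∀ᶠ s in 𝓝 x.1, CoeffAt φ s)
    (hG : ∀ᶠ y in 𝓝 x.2, RiemannianAt G y) (hx : 0 < x.1) (V : ℝ × E) (e : E) :
    (curvatureEnd (sliceForm φ G) x V V (0, e)).2 =
      curvatureEnd G x.2 V.2 V.2 e
        - (deriv φ x.1 / (2 * φ x.1 * x.1) * V.1 ^ 2 + φ x.1 * G x.2 V.2 V.2) • e
        + φ x.1 • G x.2 V.2 e • V.2 := by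
  have hφ0 := hφ.self_of_nhds.pos
  rw [curvatureEnd_apply, curvatureEnd_apply]
  simp only [fderiv_christoffel_sliceForm hφ hG hx,
    christoffel_sliceForm hφ.self_of_nhds hG.self_of_nhds hx, Prod.snd_add, Prod.snd_sub,
    map_add, map_smul, smul_eq_mul, zero_add, zero_smul, zero_div, neg_zero, zero_mul, mul_zero, zero_sub]
  rw [christoffel_symm_of_riemannianAt hG V.2 e, hG.self_of_nhds.symm e V.2]
  match_scalars <;> field_simp <;> ring

/-- Only the diagonal blocks count. On the fibre block the multiple of the identity contributes the
factor `finrank ℝ E`, and the rank-one term contributes `φ G(V, V)`. -/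
theorem trace_curvatureEnd_sliceForm (hφ : ∀ᶠ s in 𝓝 x.1, CoeffAt φ s)
    (hG : ∀ᶠ y in 𝓝 x.2, RiemannianAt G y) (hx : 0 < x.1) (V : ℝ × E) :
    LinearMap.trace ℝ (ℝ × E) (curvatureEnd (sliceForm φ G) x V V) =
      LinearMap.trace ℝ E (curvatureEnd G x.2 V.2 V.2)
        - (deriv φ x.1 / (2 * φ x.1 * x.1) * V.1 ^ 2 + φ x.1 * G x.2 V.2 V.2) *
          Module.finrank ℝ E
        + φ x.1 * G x.2 V.2 V.2 - deriv φ x.1 * x.1 / 2 * G x.2 V.2 V.2 := by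
  have h2 : LinearMap.snd ℝ ℝ E ∘ₗ curvatureEnd (sliceForm φ G) x V V ∘ₗ LinearMap.inr ℝ ℝ E =
      curvatureEnd G x.2 V.2 V.2
        - (deriv φ x.1 / (2 * φ x.1 * x.1) * V.1 ^ 2 + φ x.1 * G x.2 V.2 V.2) • LinearMap.id
        + φ x.1 • (G x.2 V.2 : E →ₗ[ℝ] ℝ).smulRight V.2 := by
    ext e
    exact curvatureEnd_sliceForm_snd hφ hG hx V e
  rw [trace_prod, h2, trace_real]
  have h1 := curvatureEnd_sliceForm_fst hφ hG hx V
  simp only [LinearMap.comp_apply, LinearMap.inl_apply, LinearMap.fst_apply, h1, map_add, map_sub,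
    map_smul, LinearMap.trace_id, trace_toSpanSingleton, smul_eq_mul]
  simp only [ContinuousLinearMap.coe_coe]
  ring

/-- The Hessian `∂²F(u, v) - ∂F(Γ(u, v))` in coordinates. -/
noncomputable def hessianForm (G : E → E →L[ℝ] E →L[ℝ] ℝ) (F : E → ℝ) (y : E) :
    E →L[ℝ] E →L[ℝ] ℝ :=
  fderiv ℝ (fderiv ℝ F) y - (ContinuousLinearMap.compL ℝ E E ℝ (fderiv ℝ F y)).comp (christoffel G y)

omit [FiniteDimensional ℝ E] in
theorem hessianForm_congr {G G' : E → E →L[ℝ] E →L[ℝ] ℝ} {F F' : E → ℝ} {y : E}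
    (hG : G =ᶠ[𝓝 y] G') (hF : F =ᶠ[𝓝 y] F') : hessianForm G F y = hessianForm G' F' y := by
  unfold hessianForm
  rw [hF.fderiv.fderiv_eq, hF.fderiv_eq, (christoffel_eventuallyEq hG).eq_of_nhds]

theorem hessianForm_sliceForm (hφ : CoeffAt φ x.1) (hψ : ∀ᶠ s in 𝓝 x.1, CoeffAt ψ s)
    (hG : RiemannianAt G x.2) (hx : 0 < x.1) (v w : ℝ × E) :
    hessianForm (sliceForm φ G) (fun z => ψ z.1) x v w =
      (deriv (deriv ψ) x.1 + deriv ψ x.1 * (deriv φ x.1 / (2 * φ x.1))) * (v.1 * w.1)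
        + deriv ψ x.1 * φ x.1 * x.1 * G x.2 v.2 w.2 := by
  have hψ0 := hψ.self_of_nhds
  have h1 : fderiv ℝ (fun z : ℝ × E => ψ z.1) =ᶠ[𝓝 x] fun z =>
      deriv ψ z.1 • ContinuousLinearMap.fst ℝ ℝ E := by
    filter_upwards [continuousAt_fst.eventually hψ] with z hz
    exact (hasFDerivAt_comp_fst hz.hasDerivAt).fderiv
  have h2 := ((hasFDerivAt_comp_fst (E := E) hψ0.hasDerivAt_deriv).smul_const
    (ContinuousLinearMap.fst ℝ ℝ E)).fderiv
  have h3 : hessianForm (sliceForm φ G) (fun z => ψ z.1) x v w =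
      fderiv ℝ (fderiv ℝ (fun z : ℝ × E => ψ z.1)) x v w
        - fderiv ℝ (fun z : ℝ × E => ψ z.1) x (christoffel (sliceForm φ G) x v w) := rfl
  rw [h3, h1.fderiv_eq, h2, h1.eq_of_nhds, christoffel_sliceForm hφ hG hx]
  simp
  ring

/-- The Hessian of a radial function is block diagonal; with an index raised it is a scalar on each
of the two factors. -/
theorem trace_inverse_hessianForm_sliceForm (hφ : CoeffAt φ x.1)
    (hψ : ∀ᶠ s in 𝓝 x.1, CoeffAt ψ s) (hG : RiemannianAt G x.2) (hx : 0 < x.1) :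
    LinearMap.trace ℝ (ℝ × E) ((sliceForm φ G x).inverse.comp
        (hessianForm (sliceForm φ G) (fun z => ψ z.1) x) : ℝ × E →L[ℝ] ℝ × E) =
      φ x.1 * (deriv (deriv ψ) x.1 + deriv ψ x.1 * (deriv φ x.1 / (2 * φ x.1)))
        + deriv ψ x.1 * φ x.1 / x.1 * Module.finrank ℝ E := by
  set L : ℝ × E →ₗ[ℝ] ℝ × E := ContinuousLinearMap.toLinearMap ((sliceForm φ G x).inverse.comp
    (hessianForm (sliceForm φ G) (fun z => ψ z.1) x))
  have hφ0 := hφ.pos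
  have hL : ∀ v, L v =
      (φ x.1 * (deriv (deriv ψ) x.1 + deriv ψ x.1 * (deriv φ x.1 / (2 * φ x.1))) * v.1,
        (deriv ψ x.1 * φ x.1 / x.1) • v.2) := by
    intro v
    change (sliceForm φ G x).inverse (hessianForm (sliceForm φ G) (fun z => ψ z.1) x v) = _
    rw [(hG.sliceForm hφ hx).isInvertible.inverse_apply_eq]
    refine ContinuousLinearMap.ext fun w => ?_
    rw [hessianForm_sliceForm hφ hψ hG hx, sliceForm_apply]
    simp only [map_smul, smul_apply, smul_eq_mul]
    field_simp
  have h2 : LinearMap.snd ℝ ℝ E ∘ₗ L ∘ₗ LinearMap.inr ℝ ℝ E =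
      (deriv ψ x.1 * φ x.1 / x.1) • LinearMap.id := by
    ext e
    simp [hL]
  rw [trace_prod, h2, trace_real]
  simp [hL]

/-- For radial unit `V` all terms cancel, which is why only the fibre part of `V` survives. The
lapse `ψ` is the primary function and `φ = ψ²`, so no square root has to be differentiated. -/
theorem substatic_sliceForm (hψ : ∀ᶠ s in 𝓝 x.1, CoeffAt ψ s)
    (hφψ : ∀ᶠ s in 𝓝 x.1, φ s = ψ s ^ 2)
    (hG : ∀ᶠ y in 𝓝 x.2, RiemannianAt G y) (hx : 0 < x.1) {n : ℕ}
    (hn : (Module.finrank ℝ E : ℝ) = n - 1) (V : ℝ × E) (hV : sliceForm φ G x V V = 1) :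
    LinearMap.trace ℝ (ℝ × E) ((sliceForm φ G x).inverse.comp
        (hessianForm (sliceForm φ G) (fun z => ψ z.1) x) : ℝ × E →L[ℝ] ℝ × E) / ψ x.1
      - hessianForm (sliceForm φ G) (fun z => ψ z.1) x V V / ψ x.1
      + LinearMap.trace ℝ (ℝ × E) (curvatureEnd (sliceForm φ G) x V V) =
    odi n φ x.1 * (x.1 ^ 2 * G x.2 V.2 V.2)
      + LinearMap.trace ℝ E (curvatureEnd G x.2 V.2 V.2) := by
  have hψ0 := hψ.self_of_nhds
  have hp := hψ0.pos
  have hφ : ∀ᶠ s in 𝓝 x.1, CoeffAt φ s := by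
    filter_upwards [hψ, hφψ.eventually_nhds] with s h1 h2
    exact ⟨(h1.contDiffAt.pow 2).congr_of_eventuallyEq h2, by
      rw [h2.self_of_nhds]; exact pow_pos h1.pos 2⟩
  have hd : deriv φ =ᶠ[𝓝 x.1] fun s => 2 * ψ s * deriv ψ s := by
    filter_upwards [hψ, hφψ.eventually_nhds] with s h1 h2
    rw [EventuallyEq.deriv_eq h2, (h1.hasDerivAt.fun_pow 2).deriv]
    simp
  have hdd : deriv (deriv φ) x.1 = 2 * (deriv ψ x.1 ^ 2 + ψ x.1 * deriv (deriv ψ) x.1) := by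
    rw [hd.deriv_eq, ((hψ0.hasDerivAt.const_mul 2).fun_mul hψ0.hasDerivAt_deriv).deriv]
    ring
  rw [trace_inverse_hessianForm_sliceForm hφ.self_of_nhds hψ hG.self_of_nhds hx,
    hessianForm_sliceForm hφ.self_of_nhds hψ hG.self_of_nhds hx,
    trace_curvatureEnd_sliceForm hφ hG hx, hn]
  rw [sliceForm_apply] at hV
  unfold odi
  rw [hdd]
  rw [hd.eq_of_nhds, hφψ.self_of_nhds] at *
  set g := G x.2 V.2 V.2
  -- The unit condition eliminates the radial component; what is left is a rational identity in `ψ`,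
  -- its derivatives and `g`.
  have hb : V.1 ^ 2 = ψ x.1 ^ 2 * (1 - x.1 ^ 2 * g) := by
    field_simp at hV
    linarith
  rw [← sq, hb]
  field_simp
  ring

end Slice

/-! ### Ricci curvature of the static spacetime on null vectors -/

section SpacetimeForm

variable {E : Type*} [NormedAddCommGroup E] [NormedSpace ℝ E]

/-- The metric `-h dt² + ds² / h + s² G` in coordinates. -/
noncomputable def spacetimeForm (h : ℝ → ℝ) (G : E → E →L[ℝ] E →L[ℝ] ℝ) (x : ℝ × ℝ × E) :
    ℝ × ℝ × E →L[ℝ] ℝ × ℝ × E →L[ℝ] ℝ :=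
  (-h x.2.1) • (ContinuousLinearMap.fst ℝ ℝ (ℝ × E)).smulRight
      (ContinuousLinearMap.fst ℝ ℝ (ℝ × E))
    + pullForm (sliceForm h G x.2) (ContinuousLinearMap.snd ℝ ℝ (ℝ × E))

theorem spacetimeForm_apply (h : ℝ → ℝ) (G : E → E →L[ℝ] E →L[ℝ] ℝ) (x v w : ℝ × ℝ × E) :
    spacetimeForm h G x v w = -h x.2.1 * (v.1 * w.1) + sliceForm h G x.2 v.2 w.2 := rfl

variable {h : ℝ → ℝ} {G : E → E →L[ℝ] E →L[ℝ] ℝ} {x : ℝ × ℝ × E}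

theorem contDiffAt_spacetimeForm (hh : CoeffAt h x.2.1) (hG : RiemannianAt G x.2.2) :
    ContDiffAt ℝ ∞ (spacetimeForm h G) x := by
  have h1 : ContDiffAt ℝ ∞ (fun z : ℝ × ℝ × E => -h z.2.1) x :=
    (hh.contDiffAt.comp x (contDiffAt_snd.fst)).neg
  have h2 : ContDiffAt ℝ ∞ (fun z : ℝ × ℝ × E => sliceForm h G z.2) x :=
    (contDiffAt_sliceForm hh hG).comp x contDiffAt_snd
  exact (h1.smul contDiffAt_const).add (contDiffAt_pullForm h2 contDiffAt_const)

/-- The time component is detected by pairing with `(1, 0)`, the spatial part by pairing it with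
itself. -/
theorem isInvertible_spacetimeForm [FiniteDimensional ℝ E] (hh : CoeffAt h x.2.1)
    (hG : RiemannianAt G x.2.2) (hx : 0 < x.2.1) : (spacetimeForm h G x).IsInvertible := by
  apply isInvertible_of_nondegenerate
  intro v hv
  have h1 : v.1 = 0 := by
    have := hv (1, 0)
    rw [spacetimeForm_apply] at this
    simpa [hh.pos.ne'] using this
  have h2 : v.2 = 0 := by
    by_contra hne
    have := hv (0, v.2)
    rw [spacetimeForm_apply] at this
    have h3 := (hG.sliceForm hh hx).pos _ hne
    simp only [mul_zero, zero_add] at this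
    exact h3.ne' this
  exact Prod.ext h1 h2

theorem fderiv_spacetimeForm (hh : CoeffAt h x.2.1) (hG : RiemannianAt G x.2.2)
    (u v w : ℝ × ℝ × E) :
    fderiv ℝ (spacetimeForm h G) x u v w =
      -(deriv h x.2.1 * u.2.1) * (v.1 * w.1) + fderiv ℝ (sliceForm h G) x.2 u.2 v.2 w.2 := by
  have hS : DifferentiableAt ℝ (sliceForm h G) x.2 :=
    (contDiffAt_sliceForm hh hG).differentiableAt (by simp)
  rw [fderiv_apply₂ ((contDiffAt_spacetimeForm hh hG).differentiableAt (by simp)),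
    fderiv_apply₂ hS]
  have h1 := ((hasFDerivAt_comp_fst (E := E) hh.hasDerivAt).comp x
    (hasFDerivAt_snd (E := ℝ))).neg.mul_const (v.1 * w.1)
  have h2 := hasFDerivAt_comp_snd (x := x) (differentiableAt_apply₂ hS v.2 w.2)
  refine (DFunLike.congr_fun (h1.add h2).fderiv u).trans ?_
  simp
  ring

/-- Beyond the slice there are only the static terms: the mixed `t`-`r` symbol `h'/(2h)` and the
radial acceleration `h h'/2` of `∂_t`. -/
theorem christoffel_spacetimeForm [FiniteDimensional ℝ E] (hh : CoeffAt h x.2.1)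
    (hG : RiemannianAt G x.2.2) (hx : 0 < x.2.1) (v w : ℝ × ℝ × E) :
    christoffel (spacetimeForm h G) x v w =
      (deriv h x.2.1 / (2 * h x.2.1) * (v.1 * w.2.1 + w.1 * v.2.1),
        christoffel (sliceForm h G) x.2 v.2 w.2
          + (h x.2.1 * deriv h x.2.1 / 2 * (v.1 * w.1), 0)) := by
  apply christoffel_eq_of_forall (isInvertible_spacetimeForm hh hG hx)
  intro z
  simp only [fderiv_spacetimeForm hh hG, spacetimeForm_apply, map_add, add_apply,
    metric_christoffel (hG.sliceForm hh hx).isInvertible]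
  rw [sliceForm_apply]
  have := hh.pos
  simp only [map_zero, zero_apply]
  field_simp
  ring

theorem fderiv_christoffel_spacetimeForm [FiniteDimensional ℝ E]
    (hh : ∀ᶠ s in 𝓝 x.2.1, CoeffAt h s)
    (hG : ∀ᶠ y in 𝓝 x.2.2, RiemannianAt G y) (hx : 0 < x.2.1) (u v w : ℝ × ℝ × E) :
    fderiv ℝ (christoffel (spacetimeForm h G)) x u v w =
      (deriv (fun s => deriv h s / (2 * h s)) x.2.1 * u.2.1 * (v.1 * w.2.1 + w.1 * v.2.1),
        fderiv ℝ (christoffel (sliceForm h G)) x.2 u.2 v.2 w.2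
          + ((deriv h x.2.1 ^ 2 + h x.2.1 * deriv (deriv h) x.2.1) / 2 * u.2.1 * (v.1 * w.1),
            0)) := by
  have hh0 := hh.self_of_nhds
  have hG0 := hG.self_of_nhds
  have hΓ := (hG0.sliceForm hh0 hx).differentiableAt_christoffel
  rw [fderiv_apply₂ (differentiableAt_christoffel (contDiffAt_spacetimeForm hh0 hG0)
    (isInvertible_spacetimeForm hh0 hG0 hx))]
  have hev : (fun z => christoffel (spacetimeForm h G) z v w) =ᶠ[𝓝 x] fun z =>
      (deriv h z.2.1 / (2 * h z.2.1) * (v.1 * w.2.1 + w.1 * v.2.1),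
        christoffel (sliceForm h G) z.2 v.2 w.2
          + (h z.2.1 * deriv h z.2.1 / 2 * (v.1 * w.1), 0)) := by
    filter_upwards [continuousAt_snd.fst.eventually hh, continuousAt_snd.snd.eventually hG,
      continuousAt_snd.fst.eventually (lt_mem_nhds hx)] with z h1 h2 h3
    exact christoffel_spacetimeForm h1 h2 h3 v w
  rw [hev.fderiv_eq]
  have hk : HasDerivAt (fun s => deriv h s / (2 * h s))
      (deriv (fun s => deriv h s / (2 * h s)) x.2.1) x.2.1 := by
    apply DifferentiableAt.hasDerivAt
    exact hh0.hasDerivAt_deriv.differentiableAt.div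
      (hh0.hasDerivAt.differentiableAt.const_mul 2) (mul_pos two_pos hh0.pos).ne'
  have hq := (hh0.hasDerivAt.mul hh0.hasDerivAt_deriv).div_const 2
  have hs := hasFDerivAt_snd (𝕜 := ℝ) (E := ℝ) (F := ℝ × E) (p := x)
  have h1 := ((hasFDerivAt_comp_fst (E := E) hk).comp x hs).mul_const
    (v.1 * w.2.1 + w.1 * v.2.1)
  have h2 := (((hasFDerivAt_comp_fst (E := E) hq).comp x hs).mul_const (v.1 * w.1)).prodMk
    (hasFDerivAt_const (0 : E) x)
  have h3 := hasFDerivAt_comp_snd (x := x) (differentiableAt_apply₂ hΓ v.2 w.2)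
  refine (DFunLike.congr_fun (h1.prodMk (h3.add h2)).fderiv u).trans ?_
  rw [fderiv_apply₂ hΓ]
  ext
  · simp
    ring
  · simp
    ring
  · simp

variable [FiniteDimensional ℝ E]

theorem curvatureEnd_spacetimeForm_fst (hh : ∀ᶠ s in 𝓝 x.2.1, CoeffAt h s)
    (hG : ∀ᶠ y in 𝓝 x.2.2, RiemannianAt G y) (hx : 0 < x.2.1) (a : ℝ) (e : E) :
    (curvatureEnd (spacetimeForm h G) x (a, 0, e) (a, 0, e) (1, 0)).1 =
      -(deriv h x.2.1 * x.2.1 / 2) * G x.2.2 e e := by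
  have hh0 := hh.self_of_nhds.pos
  rw [curvatureEnd_apply]
  simp only [fderiv_christoffel_spacetimeForm hh hG hx,
    christoffel_spacetimeForm hh.self_of_nhds hG.self_of_nhds hx,
    christoffel_sliceForm hh.self_of_nhds hG.self_of_nhds hx, Prod.fst_add, Prod.fst_sub,
    Prod.fst_zero,
    map_zero, zero_apply, mul_zero, zero_mul, add_zero, zero_add]
  field_simp
  ring

/-- Without a radial component in the vector, time enters only through `a²` times a block diagonal
map. -/
theorem curvatureEnd_spacetimeForm_snd (hh : ∀ᶠ s in 𝓝 x.2.1, CoeffAt h s)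
    (hG : ∀ᶠ y in 𝓝 x.2.2, RiemannianAt G y) (hx : 0 < x.2.1) (a : ℝ) (e : E) (z : ℝ × E) :
    (curvatureEnd (spacetimeForm h G) x (a, 0, e) (a, 0, e) (0, z)).2 =
      curvatureEnd (sliceForm h G) x.2 (0, e) (0, e) z
        + a ^ 2 • ((h x.2.1 * deriv (deriv h) x.2.1 / 2) * z.1,
          (h x.2.1 * deriv h x.2.1 / (2 * x.2.1)) • z.2) := by
  have hh0 := hh.self_of_nhds.pos
  rw [curvatureEnd_apply, curvatureEnd_apply]
  simp only [fderiv_christoffel_spacetimeForm hh hG hx,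
    christoffel_spacetimeForm hh.self_of_nhds hG.self_of_nhds hx, Prod.snd_add, Prod.snd_sub,
    map_add, mul_zero, zero_mul, add_zero, zero_add, Prod.mk_zero_zero]
  have h1 : christoffel (sliceForm h G) x.2 z (h x.2.1 * deriv h x.2.1 / 2 * (a * a), 0) =
      (-(deriv h x.2.1 ^ 2 / 4) * z.1 * a ^ 2,
        (h x.2.1 * deriv h x.2.1 / (2 * x.2.1) * a ^ 2) • z.2) := by
    rw [christoffel_sliceForm hh.self_of_nhds hG.self_of_nhds hx]
    ext
    · simp
      field_simp
      ring
    · simp [smul_smul]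
      congr 1
      field_simp
  rw [h1]
  ext
  · simp
    field_simp
    ring
  · simp
    module

/-- The counterpart of `substatic_sliceForm`, with `h` in place of `φ`. Null vectors without radial
component suffice, since they realise every fibre vector `e`. -/
theorem trace_curvatureEnd_spacetimeForm (hh : ∀ᶠ s in 𝓝 x.2.1, CoeffAt h s)
    (hG : ∀ᶠ y in 𝓝 x.2.2, RiemannianAt G y) (hx : 0 < x.2.1) {n : ℕ}
    (hn : (Module.finrank ℝ E : ℝ) = n - 1) (a : ℝ) (e : E)
    (hnull : spacetimeForm h G x (a, 0, e) (a, 0, e) = 0) :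
    LinearMap.trace ℝ (ℝ × ℝ × E) (curvatureEnd (spacetimeForm h G) x (a, 0, e) (a, 0, e)) =
      odi n h x.2.1 * (x.2.1 ^ 2 * G x.2.2 e e)
        + LinearMap.trace ℝ E (curvatureEnd G x.2.2 e e) := by
  have hh0 := hh.self_of_nhds.pos
  have h2 : LinearMap.snd ℝ ℝ (ℝ × E) ∘ₗ
      curvatureEnd (spacetimeForm h G) x (a, 0, e) (a, 0, e) ∘ₗ LinearMap.inr ℝ ℝ (ℝ × E) =
      curvatureEnd (sliceForm h G) x.2 (0, e) (0, e)
        + a ^ 2 • ((h x.2.1 * deriv (deriv h) x.2.1 / 2) •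
            (LinearMap.inl ℝ ℝ E ∘ₗ LinearMap.fst ℝ ℝ E)
          + (h x.2.1 * deriv h x.2.1 / (2 * x.2.1)) •
            (LinearMap.inr ℝ ℝ E ∘ₗ LinearMap.snd ℝ ℝ E)) := by
    apply LinearMap.ext
    intro z
    refine (curvatureEnd_spacetimeForm_snd hh hG hx a e z).trans ?_
    simp
  have h1 := curvatureEnd_spacetimeForm_fst hh hG hx a e
  rw [trace_prod, h2, trace_real]
  simp only [map_add, map_smul]
  rw [LinearMap.trace_comp_comm', LinearMap.trace_comp_comm' (LinearMap.snd ℝ ℝ E),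
    LinearMap.fst_comp_inl, LinearMap.snd_comp_inr, LinearMap.trace_id, LinearMap.trace_id,
    trace_curvatureEnd_sliceForm (x := x.2) hh hG hx, hn]
  simp only [LinearMap.comp_apply, LinearMap.inl_apply, LinearMap.fst_apply, h1]
  rw [spacetimeForm_apply, sliceForm_apply] at hnull
  -- Nullity converts the `a²` terms, including the one with `h''`, into multiples of `G(e, e)`.
  have ha : a ^ 2 = x.2.1 ^ 2 * G x.2.2 e e / h x.2.1 := by
    field_simp
    simp only [mul_zero, zero_add] at hnull
    linarith
  rw [ha]
  unfold odi
  simp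
  field_simp
  ring

end SpacetimeForm

/-! ### Tangent vectors and metrics read in a chart -/

section Chart

variable {E : Type*} [NormedAddCommGroup E] [NormedSpace ℝ E]
  {H : Type*} [TopologicalSpace H] {I : ModelWithCorners ℝ E H} [I.Boundaryless]
  {M : Type*} [TopologicalSpace M] [ChartedSpace H M] [IsManifold I 1 M]

theorem mfderiv_extChartAt_symm_coordVec (x : M) (v : TangentSpace I x) :
    (mfderiv 𝓘(ℝ, E) I (extChartAt I x).symm (extChartAt I x x) : E →L[ℝ] E)
      (coordVec (E := E) I x v) = v := by
  have h := mfderivWithin_extChartAt_symm_comp_mfderiv_extChartAt' (I := I)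
    (mem_extChartAt_source (I := I) x)
  rw [I.range_eq_univ, mfderivWithin_univ] at h
  exact DFunLike.congr_fun h v

omit [I.Boundaryless] [IsManifold I 1 M] in
theorem chartMetric_apply (g : ∀ x : M, TangentSpace I x →L[ℝ] TangentSpace I x →L[ℝ] ℝ)
    {x : M} {y : E} {f : E → M} (hf : ⇑(extChartAt I x).symm = f) {D : E →L[ℝ] E}
    (hD : HasMFDerivAt 𝓘(ℝ, E) I f y D) (v w : E) :
    chartMetric I g x y v w = (g (f y) : E →L[ℝ] E →L[ℝ] ℝ) (D v) (D w) := by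
  subst hf
  exact congrArg (fun A : E →L[ℝ] E =>
    (g ((extChartAt I x).symm y) : E →L[ℝ] E →L[ℝ] ℝ) (A v) (A w)) hD.mfderiv

theorem chartMetric_coordVec (g : ∀ x : M, TangentSpace I x →L[ℝ] TangentSpace I x →L[ℝ] ℝ)
    (x : M) (v w : TangentSpace I x) :
    chartMetric I g x (extChartAt I x x) (coordVec I x v) (coordVec I x w) = g x v w := by
  have key : ∀ q, q = x → ∀ v w : E, (g q : E →L[ℝ] E →L[ℝ] ℝ) v w =
      (g x : E →L[ℝ] E →L[ℝ] ℝ) v w := by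
    rintro _ rfl v w
    rfl
  refine (key _ (extChartAt_to_inv x) _ _).trans ?_
  exact congrArg₂ (fun a b : E => (g x : E →L[ℝ] E →L[ℝ] ℝ) a b)
    (mfderiv_extChartAt_symm_coordVec x v) (mfderiv_extChartAt_symm_coordVec x w)

-- Allows a null vector to be prescribed by its coordinates.
omit [I.Boundaryless] in
theorem coordVec_surjective (x : M) : Function.Surjective (coordVec I x) :=
  (isInvertible_mfderiv_extChartAt (mem_extChartAt_source (I := I) x)).surjective

theorem mdifferentiableAt_extChartAt_symm (x : M) {y : E} (hy : y ∈ (extChartAt I x).target) :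
    MDifferentiableAt 𝓘(ℝ, E) I (extChartAt I x).symm y := by
  have := mdifferentiableWithinAt_extChartAt_symm hy
  rwa [I.range_eq_univ, mdifferentiableWithinAt_univ] at this

theorem mfderiv_extChartAt_symm_injective (x : M) {y : E} (hy : y ∈ (extChartAt I x).target) :
    Function.Injective (mfderiv 𝓘(ℝ, E) I (extChartAt I x).symm y) := by
  have := isInvertible_mfderivWithin_extChartAt_symm hy
  rw [I.range_eq_univ, mfderivWithin_univ] at this
  exact this.injective

end Chart

/-! ### Smoothness and positivity of the fibre metric in charts -/

section Fibre

variable {E : Type*} [NormedAddCommGroup E] [NormedSpace ℝ E]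
  {N : Type*} [TopologicalSpace N] [ChartedSpace E N] [IsManifold 𝓘(ℝ, E) ∞ N]
  (gN : Bundle.ContMDiffRiemannianMetric 𝓘(ℝ, E) ∞ E (TangentSpace 𝓘(ℝ, E) : N → Type _))

/-- Smoothness of `gN` is a statement about bundle trivializations; this identification turns it
into smoothness of the coordinate metric. -/
theorem chartMetric_eq_trivializationAt (p q : N) (hq : q ∈ (chartAt E p).source) :
    chartMetric 𝓘(ℝ, E) gN.inner p (extChartAt 𝓘(ℝ, E) p q) =
      (trivializationAt (E →L[ℝ] E →L[ℝ] ℝ)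
        (fun x : N => TangentSpace 𝓘(ℝ, E) x →L[ℝ] TangentSpace 𝓘(ℝ, E) x →L[ℝ] ℝ) p
        ⟨q, gN.inner q⟩).2 := by
  have : IsManifold 𝓘(ℝ, E) 1 N := IsManifold.of_le (n := ∞) (by simp)
  rw [hom_trivializationAt_apply]
  refine ContinuousLinearMap.ext fun v => ContinuousLinearMap.ext fun w => ?_
  rw [inCoordinates_apply_eq₂ (by simpa using hq) (by simpa using hq) (by simp)]
  have hs := TangentBundle.symmL_trivializationAt (I := 𝓘(ℝ, E)) hq
  rw [ModelWithCorners.range_eq_univ, mfderivWithin_univ] at hs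
  have key : ∀ q', q' = q → ∀ v w : E, (gN.inner q' : E →L[ℝ] E →L[ℝ] ℝ) v w =
      (gN.inner q : E →L[ℝ] E →L[ℝ] ℝ) v w := by
    rintro _ rfl v w
    rfl
  have hq' : q ∈ (extChartAt 𝓘(ℝ, E) p).source := by simpa using hq
  refine (key _ ((extChartAt 𝓘(ℝ, E) p).left_inv hq') _ _).trans ?_
  have h1 : ∀ v, (trivializationAt E (TangentSpace 𝓘(ℝ, E)) p).symm q v =
      mfderiv 𝓘(ℝ, E) 𝓘(ℝ, E) (extChartAt 𝓘(ℝ, E) p).symm (extChartAt 𝓘(ℝ, E) p q) v :=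
    fun v => ((trivializationAt E (TangentSpace 𝓘(ℝ, E)) p).symmL_apply (R := ℝ)
      (by simpa using hq) v).symm.trans (DFunLike.congr_fun hs v)
  rw [h1, h1]
  simp
  rfl

theorem riemannianAt_chartMetric (p : N) {y : E} (hy : y ∈ (extChartAt 𝓘(ℝ, E) p).target) :
    RiemannianAt (chartMetric 𝓘(ℝ, E) gN.inner p) y := by
  have : IsManifold 𝓘(ℝ, E) 1 N := IsManifold.of_le (n := ∞) (by simp)
  refine ⟨?_, fun v w => gN.symm _ _ _, fun v hv => gN.pos _ _ ?_⟩
  · have hq : (extChartAt 𝓘(ℝ, E) p).symm y ∈ (chartAt E p).source := by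
      have := (extChartAt 𝓘(ℝ, E) p).map_target hy
      rwa [extChartAt_source] at this
    have h1 := ((trivializationAt (E →L[ℝ] E →L[ℝ] ℝ)
      (fun x : N => TangentSpace 𝓘(ℝ, E) x →L[ℝ] TangentSpace 𝓘(ℝ, E) x →L[ℝ] ℝ)
        p).contMDiffAt_section_iff (IB := 𝓘(ℝ, E)) (n := ∞) (s := gN.inner)
        (x₀ := (extChartAt 𝓘(ℝ, E) p).symm y) (by simpa using hq)).1 (gN.contMDiff _)
    have h2 : ContMDiffAt 𝓘(ℝ, E) 𝓘(ℝ, E) ∞ (extChartAt 𝓘(ℝ, E) p).symm y :=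
      (contMDiffOn_extChartAt_symm p).contMDiffAt ((isOpen_extChartAt_target p).mem_nhds hy)
    have h3 := (h1.comp y h2).contDiffAt
    refine h3.congr_of_eventuallyEq ?_
    filter_upwards [(isOpen_extChartAt_target p).mem_nhds hy] with z hz
    have hq : (extChartAt 𝓘(ℝ, E) p).symm z ∈ (chartAt E p).source := by
      have := (extChartAt 𝓘(ℝ, E) p).map_target hz
      rwa [extChartAt_source] at this
    have := chartMetric_eq_trivializationAt gN p _ hq
    rwa [(extChartAt 𝓘(ℝ, E) p).right_inv hz] at this
  · intro h0
    apply hv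
    exact mfderiv_extChartAt_symm_injective (I := 𝓘(ℝ, E)) p hy (h0.trans (map_zero _).symm)

theorem eventually_riemannianAt_chartMetric (p : N) :
    ∀ᶠ y in 𝓝 (extChartAt 𝓘(ℝ, E) p p), RiemannianAt (chartMetric 𝓘(ℝ, E) gN.inner p) y := by
  filter_upwards [extChartAt_target_mem_nhds p] with y hy using riemannianAt_chartMetric gN p hy

end Fibre

/-! ### Graph and spacetime metrics in product charts -/

section Product

variable {E : Type*} [NormedAddCommGroup E] [NormedSpace ℝ E]
  {N : Type*} [TopologicalSpace N] [ChartedSpace E N] [IsManifold 𝓘(ℝ, E) ∞ N]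
  (gN : Bundle.ContMDiffRiemannianMetric 𝓘(ℝ, E) ∞ E (TangentSpace 𝓘(ℝ, E) : N → Type _))

omit [IsManifold 𝓘(ℝ, E) ∞ N] in
theorem extChartAt_sliceModel_symm (q : ℝ × N) :
    ((extChartAt (sliceModel E) q).symm : ℝ × E → ℝ × N) =
      fun z => (z.1, (extChartAt 𝓘(ℝ, E) q.2).symm z.2) := by
  simp only [extChartAt_prod, PartialEquiv.prod_symm, extChartAt_model_space_eq_id]
  rfl

omit [IsManifold 𝓘(ℝ, E) ∞ N] in
theorem extChartAt_sliceModel_self (q : ℝ × N) :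
    extChartAt (sliceModel E) q q = (q.1, extChartAt 𝓘(ℝ, E) q.2 q.2) := by
  simp only [extChartAt_prod, extChartAt_model_space_eq_id]
  rfl

omit [IsManifold 𝓘(ℝ, E) ∞ N] in
theorem extChartAt_spacetimeModel_symm (q : ℝ × ℝ × N) :
    ((extChartAt (spacetimeModel E) q).symm : ℝ × ℝ × E → ℝ × ℝ × N) =
      fun z => (z.1, z.2.1, (extChartAt 𝓘(ℝ, E) q.2.2).symm z.2.2) := by
  simp only [extChartAt_prod, PartialEquiv.prod_symm, extChartAt_model_space_eq_id]
  rfl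

omit [IsManifold 𝓘(ℝ, E) ∞ N] in
theorem extChartAt_spacetimeModel_self (q : ℝ × ℝ × N) :
    extChartAt (spacetimeModel E) q q = (q.1, q.2.1, extChartAt 𝓘(ℝ, E) q.2.2 q.2.2) := by
  simp only [extChartAt_prod, extChartAt_model_space_eq_id]
  rfl

theorem hasMFDerivAt_extChartAt_sliceModel_symm (p : N) {y : ℝ × E}
    (hy : y.2 ∈ (extChartAt 𝓘(ℝ, E) p).target) :
    HasMFDerivAt 𝓘(ℝ, ℝ × E) (sliceModel E)
      (fun z : ℝ × E => (z.1, (extChartAt 𝓘(ℝ, E) p).symm z.2)) y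
      ((ContinuousLinearMap.fst ℝ ℝ E).prod
        ((mfderiv 𝓘(ℝ, E) 𝓘(ℝ, E) (extChartAt 𝓘(ℝ, E) p).symm y.2 : E →L[ℝ] E).comp
          (ContinuousLinearMap.snd ℝ ℝ E))) := by
  have : IsManifold 𝓘(ℝ, E) 1 N := IsManifold.of_le (n := ∞) (by simp)
  have h1 : HasMFDerivAt 𝓘(ℝ, ℝ × E) 𝓘(ℝ, ℝ) (fun z : ℝ × E => z.1) y
      (ContinuousLinearMap.fst ℝ ℝ E) := hasFDerivAt_fst.hasMFDerivAt
  have h2 : HasMFDerivAt 𝓘(ℝ, ℝ × E) 𝓘(ℝ, E) (fun z : ℝ × E => z.2) y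
      (ContinuousLinearMap.snd ℝ ℝ E) := hasFDerivAt_snd.hasMFDerivAt
  have h3 := (mdifferentiableAt_extChartAt_symm (I := 𝓘(ℝ, E)) p hy).hasMFDerivAt
  exact h1.prodMk (HasMFDerivAt.comp y h3 h2)

theorem hasMFDerivAt_extChartAt_spacetimeModel_symm (p : N) {y : ℝ × ℝ × E}
    (hy : y.2.2 ∈ (extChartAt 𝓘(ℝ, E) p).target) :
    HasMFDerivAt 𝓘(ℝ, ℝ × ℝ × E) (spacetimeModel E)
      (fun z : ℝ × ℝ × E => (z.1, z.2.1, (extChartAt 𝓘(ℝ, E) p).symm z.2.2)) y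
      ((ContinuousLinearMap.fst ℝ ℝ (ℝ × E)).prod
        (((ContinuousLinearMap.fst ℝ ℝ E).comp (ContinuousLinearMap.snd ℝ ℝ (ℝ × E))).prod
        ((mfderiv 𝓘(ℝ, E) 𝓘(ℝ, E) (extChartAt 𝓘(ℝ, E) p).symm y.2.2 : E →L[ℝ] E).comp
          ((ContinuousLinearMap.snd ℝ ℝ E).comp (ContinuousLinearMap.snd ℝ ℝ (ℝ × E)))))) := by
  have : IsManifold 𝓘(ℝ, E) 1 N := IsManifold.of_le (n := ∞) (by simp)
  have h1 : HasMFDerivAt 𝓘(ℝ, ℝ × ℝ × E) 𝓘(ℝ, ℝ) (fun z : ℝ × ℝ × E => z.1) y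
      (ContinuousLinearMap.fst ℝ ℝ (ℝ × E)) := hasFDerivAt_fst.hasMFDerivAt
  have h2 : HasMFDerivAt 𝓘(ℝ, ℝ × ℝ × E) 𝓘(ℝ, ℝ) (fun z : ℝ × ℝ × E => z.2.1) y
      ((ContinuousLinearMap.fst ℝ ℝ E).comp (ContinuousLinearMap.snd ℝ ℝ (ℝ × E))) :=
    hasFDerivAt_snd.fst.hasMFDerivAt
  have h2' : HasMFDerivAt 𝓘(ℝ, ℝ × ℝ × E) 𝓘(ℝ, E) (fun z : ℝ × ℝ × E => z.2.2) y
      ((ContinuousLinearMap.snd ℝ ℝ E).comp (ContinuousLinearMap.snd ℝ ℝ (ℝ × E))) :=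
    hasFDerivAt_snd.snd.hasMFDerivAt
  have h3 := (mdifferentiableAt_extChartAt_symm (I := 𝓘(ℝ, E)) p hy).hasMFDerivAt
  exact h1.prodMk (h2.prodMk (HasMFDerivAt.comp y h3 h2'))

theorem spacetimeMetric_apply (h : ℝ → ℝ) (x : ℝ × ℝ × N) (v w : ℝ × ℝ × E) :
    (spacetimeMetric h gN x : ℝ × ℝ × E →L[ℝ] ℝ × ℝ × E →L[ℝ] ℝ) v w =
      -h x.2.1 * (v.1 * w.1) + 1 / h x.2.1 * (v.2.1 * w.2.1)
        + x.2.1 ^ 2 * (gN.inner x.2.2 : E →L[ℝ] E →L[ℝ] ℝ) v.2.2 w.2.2 := by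
  have ht : mfderiv (spacetimeModel E) 𝓘(ℝ, ℝ) (fun q : ℝ × ℝ × N => q.1) x =
      ContinuousLinearMap.fst ℝ ℝ (ℝ × E) := mfderiv_fst
  have hs := hasMFDerivAt_snd (I := 𝓘(ℝ, ℝ)) (I' := 𝓘(ℝ, ℝ).prod 𝓘(ℝ, E)) x
  have hr : mfderiv (spacetimeModel E) 𝓘(ℝ, ℝ) (fun q : ℝ × ℝ × N => q.2.1) x =
      (ContinuousLinearMap.fst ℝ ℝ E).comp (ContinuousLinearMap.snd ℝ ℝ (ℝ × E)) :=
    (HasMFDerivAt.comp x (hasMFDerivAt_fst (I := 𝓘(ℝ, ℝ)) (I' := 𝓘(ℝ, E)) x.2) hs).mfderiv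
  have hp : mfderiv (spacetimeModel E) 𝓘(ℝ, E) (fun q : ℝ × ℝ × N => q.2.2) x =
      (ContinuousLinearMap.snd ℝ ℝ E).comp (ContinuousLinearMap.snd ℝ ℝ (ℝ × E)) :=
    (HasMFDerivAt.comp x (hasMFDerivAt_snd (I := 𝓘(ℝ, ℝ)) (I' := 𝓘(ℝ, E)) x.2) hs).mfderiv
  unfold spacetimeMetric
  rw [ht, hr, hp]
  rfl

theorem graphMetric_apply (h : ℝ → ℝ) {T : ℝ → ℝ} {q : ℝ × N} (hT : DifferentiableAt ℝ T q.1)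
    (v w : ℝ × E) :
    (graphMetric h gN T q : ℝ × E →L[ℝ] ℝ × E →L[ℝ] ℝ) v w =
      (1 / h q.1 - h q.1 * deriv T q.1 ^ 2) * (v.1 * w.1)
        + q.1 ^ 2 * (gN.inner q.2 : E →L[ℝ] E →L[ℝ] ℝ) v.2 w.2 := by
  have h1 := hasMFDerivAt_fst (I := 𝓘(ℝ, ℝ)) (I' := 𝓘(ℝ, E)) q
  have h2 := hasMFDerivAt_snd (I := 𝓘(ℝ, ℝ)) (I' := 𝓘(ℝ, E)) q
  have h3 : HasMFDerivAt 𝓘(ℝ, ℝ) 𝓘(ℝ, ℝ) T q.1 (ContinuousLinearMap.toSpanSingleton ℝ (deriv T q.1)) :=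
    hT.hasDerivAt.hasFDerivAt.hasMFDerivAt
  have h4 := ((HasMFDerivAt.comp q h3 h1).prodMk (h1.prodMk h2)).mfderiv
  have key : ∀ v : ℝ × E, (mfderiv (sliceModel E) (spacetimeModel E) (graphMap N T) q :
      ℝ × E →L[ℝ] ℝ × ℝ × E) v = (v.1 * deriv T q.1, v.1, v.2) := fun v => DFunLike.congr_fun h4 v
  refine (congrArg₂ (fun a b : ℝ × ℝ × E =>
    (spacetimeMetric h gN (graphMap N T q) : ℝ × ℝ × E →L[ℝ] ℝ × ℝ × E →L[ℝ] ℝ) a b)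
      (key v) (key w)).trans ?_
  refine (spacetimeMetric_apply gN h (graphMap N T q) _ _).trans ?_
  refine congrArg₂ (· + ·) ?_ rfl
  simp only [graphMap]
  ring

theorem chartMetric_graphMetric (h : ℝ → ℝ) {T : ℝ → ℝ} (q : ℝ × N) {y : ℝ × E}
    (hT : DifferentiableAt ℝ T y.1) (hh : h y.1 ≠ 0)
    (hy : y.2 ∈ (extChartAt 𝓘(ℝ, E) q.2).target) :
    chartMetric (sliceModel E) (graphMetric h gN T) q y =
      sliceForm (graphCoeff h T) (chartMetric 𝓘(ℝ, E) gN.inner q.2) y := by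
  refine ContinuousLinearMap.ext fun v => ContinuousLinearMap.ext fun w => ?_
  rw [sliceForm_apply]
  refine (chartMetric_apply _ (extChartAt_sliceModel_symm q)
    (hasMFDerivAt_extChartAt_sliceModel_symm q.2 hy) v w).trans ?_
  refine (graphMetric_apply gN h (q := (y.1, (extChartAt 𝓘(ℝ, E) q.2).symm y.2)) hT _ _).trans ?_
  -- Spacelikeness is not needed here: with `1 / 0 = 0` the identity persists when the denominator
  -- of `graphCoeff` vanishes.
  have : 1 / h y.1 - h y.1 * deriv T y.1 ^ 2 = 1 / graphCoeff h T y.1 := by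
    rw [graphCoeff]
    field_simp
  rw [← this]
  rfl

theorem chartMetric_spacetimeMetric (h : ℝ → ℝ) (q : ℝ × ℝ × N) {y : ℝ × ℝ × E}
    (hy : y.2.2 ∈ (extChartAt 𝓘(ℝ, E) q.2.2).target) :
    chartMetric (spacetimeModel E) (spacetimeMetric h gN) q y =
      spacetimeForm h (chartMetric 𝓘(ℝ, E) gN.inner q.2.2) y := by
  refine ContinuousLinearMap.ext fun v => ContinuousLinearMap.ext fun w => ?_
  rw [spacetimeForm_apply, sliceForm_apply]
  refine (chartMetric_apply _ (extChartAt_spacetimeModel_symm q)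
    (hasMFDerivAt_extChartAt_spacetimeModel_symm q.2.2 hy) v w).trans ?_
  refine (spacetimeMetric_apply gN h
    (y.1, y.2.1, (extChartAt 𝓘(ℝ, E) q.2.2).symm y.2.2) _ _).trans ?_
  rw [add_assoc]
  rfl

end Product

/-! ### Transfer of the two identities to the graph and the spacetime -/

section Graph

variable {E : Type*} [NormedAddCommGroup E] [NormedSpace ℝ E]
  {N : Type*} [TopologicalSpace N] [ChartedSpace E N] [IsManifold 𝓘(ℝ, E) ∞ N]
  (gN : Bundle.ContMDiffRiemannianMetric 𝓘(ℝ, E) ∞ E (TangentSpace 𝓘(ℝ, E) : N → Type _))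

theorem coordVec_sliceModel_snd (q : ℝ × N) (V : ℝ × E) :
    (coordVec (E := ℝ × E) (sliceModel E) q V).2 = coordVec (E := E) 𝓘(ℝ, E) q.2 V.2 := by
  have : IsManifold 𝓘(ℝ, E) 1 N := IsManifold.of_le (n := ∞) (by simp)
  have hf : (extChartAt (sliceModel E) q : ℝ × N → ℝ × E) =
      fun z => (z.1, extChartAt 𝓘(ℝ, E) q.2 z.2) := by
    simp only [extChartAt_prod, extChartAt_model_space_eq_id]
    rfl
  have h1 := hasMFDerivAt_fst (I := 𝓘(ℝ, ℝ)) (I' := 𝓘(ℝ, E)) q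
  have h2 := HasMFDerivAt.comp q (mdifferentiableAt_extChartAt (I := 𝓘(ℝ, E))
    (mem_chart_source E q.2)).hasMFDerivAt (hasMFDerivAt_snd (I := 𝓘(ℝ, ℝ)) (I' := 𝓘(ℝ, E)) q)
  have h3 : HasMFDerivAt (sliceModel E) 𝓘(ℝ, ℝ × E) (extChartAt (sliceModel E) q) q
      ((ContinuousLinearMap.fst ℝ ℝ E).prod
        ((mfderiv 𝓘(ℝ, E) 𝓘(ℝ, E) (extChartAt 𝓘(ℝ, E) q.2) q.2 : E →L[ℝ] E).comp
          (ContinuousLinearMap.snd ℝ ℝ E))) := by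
    rw [hf]
    exact ⟨h1.1.prodMk h2.1, h1.2.prodMk h2.2⟩
  exact congrArg Prod.snd (DFunLike.congr_fun h3.mfderiv V)

theorem graphTensor_apply (n : ℕ) (h T : ℝ → ℝ) (q : ℝ × N) (V : TangentSpace (sliceModel E) q) :
    graphTensor n h gN T q V V = odi n (fun s => graphCoeff h T s - h s) q.1 *
      (q.1 ^ 2 * chartMetric 𝓘(ℝ, E) gN.inner q.2 (extChartAt 𝓘(ℝ, E) q.2 q.2)
        (coordVec (sliceModel E) q V).2 (coordVec (sliceModel E) q V).2) := by
  have : IsManifold 𝓘(ℝ, E) 1 N := IsManifold.of_le (n := ∞) (by simp)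
  have h1 : mfderiv (sliceModel E) 𝓘(ℝ, E) (fun q' : ℝ × N => q'.2) q =
      ContinuousLinearMap.snd ℝ ℝ E := mfderiv_snd
  have key : ∀ W : TangentSpace 𝓘(ℝ, E) q.2,
      (coordVec (sliceModel E) q V).2 = coordVec 𝓘(ℝ, E) q.2 W →
      gN.inner q.2 W W = chartMetric 𝓘(ℝ, E) gN.inner q.2 (extChartAt 𝓘(ℝ, E) q.2 q.2)
        (coordVec (sliceModel E) q V).2 (coordVec (sliceModel E) q V).2 := by
    intro W hW
    rw [hW, chartMetric_coordVec]
  rw [← key _ (coordVec_sliceModel_snd q V)]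
  unfold graphTensor
  rw [h1]
  rfl

variable [FiniteDimensional ℝ E] {n : ℕ} {rH : ℝ} {h T : ℝ → ℝ} {r₁ : ℝ} {r₂ : EReal}

theorem isOpen_radialInterval (r₁ : ℝ) (r₂ : EReal) : IsOpen (radialInterval r₁ r₂) :=
  (isOpen_lt continuous_const continuous_id).inter
    (isOpen_lt continuous_coe_real_ereal continuous_const)

theorem IsMetricCoefficient.coeffAt (hh : IsMetricCoefficient rH h) {s : ℝ} (hs : rH < s) :
    CoeffAt h s :=
  ⟨hh.smooth.contDiffAt (Ioi_mem_nhds (hh.nonneg.trans_lt hs)), hh.pos s hs⟩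

theorem IsMetricCoefficient.eventually_coeffAt (hh : IsMetricCoefficient rH h) {s : ℝ}
    (hs : rH < s) : ∀ᶠ s' in 𝓝 s, CoeffAt h s' := by
  filter_upwards [lt_mem_nhds hs] with s' hs' using hh.coeffAt hs'

variable {gN}

omit [FiniteDimensional ℝ E] in
theorem IsWarpedProductGraph.coeffAt_graphCoeff (hT : IsWarpedProductGraph rH h gN T r₁ r₂)
    (hh : IsMetricCoefficient rH h) (p : N) {s : ℝ} (hs : s ∈ radialInterval r₁ r₂) :
    CoeffAt (graphCoeff h T) s := by
  have hhs := hh.coeffAt (hT.le_left.trans_lt hs.1)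
  have hTs : ContDiffAt ℝ ∞ T s :=
    hT.smooth.contDiffAt ((isOpen_radialInterval r₁ r₂).mem_nhds hs)
  -- Testing on the radial vector gives `1/h - h (T')² > 0`, hence a positive denominator in
  -- `graphCoeff`. The point `p` is required because spacelikeness is vacuous over an empty fibre.
  have hsp := hT.spacelike s hs p ((1, 0) : ℝ × E) (by
    intro h0
    exact one_ne_zero (congrArg Prod.fst h0 : (1 : ℝ) = 0))
  have hsp' := hsp.trans_eq (graphMetric_apply gN h (q := (s, p))
    (hTs.differentiableAt (by simp)) (1, 0) (1, 0))
  have h0 : (gN.inner p : E →L[ℝ] E →L[ℝ] ℝ) 0 0 = 0 := by simp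
  have hpos : 0 < 1 - h s * (h s * deriv T s ^ 2) := by
    have h1 : 0 < 1 / h s - h s * deriv T s ^ 2 := by
      refine hsp'.trans_eq ?_
      rw [mul_one, mul_one]
      refine (congrArg (_ + s ^ 2 * ·) h0).trans ?_
      rw [mul_zero, add_zero]
    have h2 := mul_pos hhs.pos h1
    have h3 := hhs.pos.ne'
    field_simp at h2
    linarith
  have hdT : ContDiffAt ℝ ∞ (deriv T) s := by
    have : deriv T = fun x => fderiv ℝ T x 1 := by ext x; simp
    rw [this]
    exact (hTs.fderiv_right (m := ∞) (by simp)).clm_apply contDiffAt_const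
  exact ⟨hhs.contDiffAt.div (contDiffAt_const.sub
    (hhs.contDiffAt.mul (hhs.contDiffAt.mul (hdT.pow 2)))) hpos.ne', div_pos hhs.pos hpos⟩

theorem odi_sub {φ ψ : ℝ → ℝ} {s : ℝ} (hφ : ∀ᶠ s' in 𝓝 s, CoeffAt φ s')
    (hψ : ∀ᶠ s' in 𝓝 s, CoeffAt ψ s') :
    odi n (fun s' => φ s' - ψ s') s = odi n φ s - odi n ψ s := by
  have h1 : deriv (fun s' => φ s' - ψ s') =ᶠ[𝓝 s] fun s' => deriv φ s' - deriv ψ s' := by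
    filter_upwards [hφ, hψ] with s' h1 h2 using (h1.hasDerivAt.sub h2.hasDerivAt).deriv
  have h2 := (hφ.self_of_nhds.hasDerivAt_deriv.fun_sub hψ.self_of_nhds.hasDerivAt_deriv).deriv
  unfold odi
  rw [h1.deriv_eq, h2, h1.eq_of_nhds]
  ring

theorem NullEnergyCondition.odi_add_ricci_nonneg (hh : IsMetricCoefficient rH h)
    (hn : (Module.finrank ℝ E : ℝ) = n - 1)
    (hNEC : NullEnergyCondition (spacetimeModel E) (spacetimeMetric h gN)
      (spacetimeRegion N rH)) {s : ℝ} (hs : rH < s) (p : N) (e : E) :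
    0 ≤ odi n h s *
        (s ^ 2 * chartMetric 𝓘(ℝ, E) gN.inner p (extChartAt 𝓘(ℝ, E) p p) e e)
      + LinearMap.trace ℝ E (curvatureEnd (chartMetric 𝓘(ℝ, E) gN.inner p)
          (extChartAt 𝓘(ℝ, E) p p) e e) := by
  have : IsManifold 𝓘(ℝ, E) 1 N := IsManifold.of_le (n := ∞) (by simp)
  have hs0 : 0 < s := hh.nonneg.trans_lt hs
  have hhs := hh.coeffAt hs
  set G := chartMetric 𝓘(ℝ, E) gN.inner p
  set y := extChartAt 𝓘(ℝ, E) p p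
  have hG : ∀ᶠ z in 𝓝 y, RiemannianAt G z := eventually_riemannianAt_chartMetric gN p
  -- The time `0` is arbitrary, the metric being static.
  set x : ℝ × ℝ × N := (0, s, p)
  have hx : extChartAt (spacetimeModel E) x x = (0, s, y) := extChartAt_spacetimeModel_self x
  have hform : chartMetric (spacetimeModel E) (spacetimeMetric h gN) x =ᶠ[𝓝 (0, s, y)]
      spacetimeForm h G := by
    have : ∀ᶠ z : ℝ × ℝ × E in 𝓝 (0, s, y), z.2.2 ∈ (extChartAt 𝓘(ℝ, E) p).target :=
      continuousAt_snd.snd.eventually (extChartAt_target_mem_nhds (I := 𝓘(ℝ, E)) p)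
    filter_upwards [this] with z hz using chartMetric_spacetimeMetric gN h x hz
  have hg : 0 ≤ G y e e := by
    by_cases he : e = 0
    · simp [he]
    · exact (hG.self_of_nhds.pos e he).le
  -- The time component is the nonnegative root of `h a² = s² G(e, e)`, which makes the lift of `e`
  -- null.
  obtain ⟨L, hL⟩ := coordVec_surjective (I := spacetimeModel E) x
    ((√(s ^ 2 * G y e e / h s), 0, e) : ℝ × ℝ × E)
  have hnull : spacetimeForm h G (0, s, y) (√(s ^ 2 * G y e e / h s), 0, e)
      (√(s ^ 2 * G y e e / h s), 0, e) = 0 := by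
    have := hhs.pos
    rw [spacetimeForm_apply, sliceForm_apply]
    simp only [Real.mul_self_sqrt (show 0 ≤ s ^ 2 * G y e e / h s by positivity)]
    field_simp
    ring
  have hLL : spacetimeMetric h gN x L L = 0 := by
    rw [← chartMetric_coordVec, hL, hx, hform.eq_of_nhds, hnull]
  have hric := hNEC x hs L hLL
  unfold ricci at hric
  rw [hL, hx, curvatureEnd_congr hform, trace_curvatureEnd_spacetimeForm (x := (0, s, y))
    (hh.eventually_coeffAt hs) hG hs0 hn _ _ hnull] at hric
  exact hric

theorem IsWarpedProductGraph.substatic_eq (hT : IsWarpedProductGraph rH h gN T r₁ r₂)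
    (hh : IsMetricCoefficient rH h) (hn : (Module.finrank ℝ E : ℝ) = n - 1) {s : ℝ}
    (hs : s ∈ radialInterval r₁ r₂) (p : N) (V : TangentSpace (sliceModel E) (s, p))
    (hV : graphMetric h gN T (s, p) V V = 1) :
    laplacian (sliceModel E) (graphMetric h gN T) (graphLapse N h T) (s, p) /
          graphLapse N h T (s, p)
        - hessian (sliceModel E) (graphMetric h gN T) (graphLapse N h T) (s, p) V V /
          graphLapse N h T (s, p)
        + ricci (sliceModel E) (graphMetric h gN T) (s, p) V V =
      odi n (graphCoeff h T) s *
        (s ^ 2 * chartMetric 𝓘(ℝ, E) gN.inner p (extChartAt 𝓘(ℝ, E) p p)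
          (coordVec (sliceModel E) (s, p) V).2 (coordVec (sliceModel E) (s, p) V).2)
      + LinearMap.trace ℝ E (curvatureEnd (chartMetric 𝓘(ℝ, E) gN.inner p)
          (extChartAt 𝓘(ℝ, E) p p)
          (coordVec (sliceModel E) (s, p) V).2 (coordVec (sliceModel E) (s, p) V).2) := by
  have : IsManifold 𝓘(ℝ, E) 1 N := IsManifold.of_le (n := ∞) (by simp)
  have hrs : rH < s := hT.le_left.trans_lt hs.1
  set G := chartMetric 𝓘(ℝ, E) gN.inner p
  set y := extChartAt 𝓘(ℝ, E) p p
  have hG : ∀ᶠ z in 𝓝 y, RiemannianAt G z := eventually_riemannianAt_chartMetric gN p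
  have hx : extChartAt (sliceModel E) (s, p) (s, p) = (s, y) :=
    extChartAt_sliceModel_self (s, p)
  have hI : ∀ᶠ s' in 𝓝 s, s' ∈ radialInterval r₁ r₂ :=
    (isOpen_radialInterval r₁ r₂).mem_nhds hs
  have hφ : ∀ᶠ s' in 𝓝 s, CoeffAt (graphCoeff h T) s' :=
    hI.mono fun _ hs' => hT.coeffAt_graphCoeff hh p hs'
  have hψ : ∀ᶠ s' in 𝓝 s, CoeffAt (fun r => √(graphCoeff h T r)) s' :=
    hφ.mono fun _ hs' => ⟨hs'.contDiffAt.sqrt hs'.pos.ne', Real.sqrt_pos.2 hs'.pos⟩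
  have hφψ : ∀ᶠ s' in 𝓝 s, graphCoeff h T s' = √(graphCoeff h T s') ^ 2 :=
    hφ.mono fun _ hs' => (Real.sq_sqrt hs'.pos.le).symm
  -- Equality of germs suffices for curvature and Hessian; it holds only where `T` is differentiable
  -- and the chart inverse is defined.
  have hform : chartMetric (sliceModel E) (graphMetric h gN T) (s, p) =ᶠ[𝓝 (s, y)]
      sliceForm (graphCoeff h T) G := by
    have h1 : ∀ᶠ z : ℝ × E in 𝓝 (s, y), z.2 ∈ (extChartAt 𝓘(ℝ, E) p).target :=
      continuousAt_snd.eventually (extChartAt_target_mem_nhds (I := 𝓘(ℝ, E)) p)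
    have h2 : ∀ᶠ z : ℝ × E in 𝓝 (s, y), z.1 ∈ radialInterval r₁ r₂ :=
      continuousAt_fst.eventually hI
    filter_upwards [h1, h2] with z hz1 hz2
    exact chartMetric_graphMetric gN h (s, p)
      ((hT.smooth.contDiffAt ((isOpen_radialInterval r₁ r₂).mem_nhds hz2)).differentiableAt
        (by simp)) (hh.pos _ (hT.le_left.trans_lt hz2.1)).ne' hz1
  have hlapse : graphLapse N h T ∘ (extChartAt (sliceModel E) (s, p)).symm =
      fun z : ℝ × E => √(graphCoeff h T z.1) := by
    rw [extChartAt_sliceModel_symm]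
    rfl
  have hhess : chartHessian (sliceModel E) (graphMetric h gN T) (graphLapse N h T) (s, p) =
      hessianForm (sliceForm (graphCoeff h T) G) (fun z => √(graphCoeff h T z.1)) (s, y) := by
    rw [← hessianForm_congr hform (Eq.eventuallyEq hlapse), ← hx]
    rfl
  rw [← chartMetric_coordVec, hx, hform.eq_of_nhds] at hV
  have key := substatic_sliceForm (x := (s, y)) hψ hφψ hG (hh.nonneg.trans_lt hrs) hn _ hV
  rw [← key]
  unfold laplacian hessian ricci
  rw [hhess, hx, hform.eq_of_nhds, curvatureEnd_congr hform]
  rfl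

end Graph

end ClassH

/-! ### Comparison of the two identities -/

theorem mainTheorem6
    {E : Type*} [NormedAddCommGroup E] [NormedSpace ℝ E] [FiniteDimensional ℝ E]
    {N : Type*} [TopologicalSpace N] [T2Space N] [CompactSpace N] [ChartedSpace E N]
    [IsManifold 𝓘(ℝ, E) ∞ N]
    (n : ℕ) (hn : 3 ≤ n) (hdim : Module.finrank ℝ E = n - 1)
    (gN : Bundle.ContMDiffRiemannianMetric 𝓘(ℝ, E) ∞ E (TangentSpace 𝓘(ℝ, E) : N → Type _))
    (rH : ℝ) (h : ℝ → ℝ) (hh : IsMetricCoefficient rH h)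
    (hNEC : NullEnergyCondition (spacetimeModel E) (spacetimeMetric h gN)
      (spacetimeRegion N rH))
    (T : ℝ → ℝ) (r₁ : ℝ) (r₂ : EReal)
    (hT : IsWarpedProductGraph rH h gN T r₁ r₂) :
    (∀ s ∈ radialInterval r₁ r₂, ∀ (p : N) (V : TangentSpace (sliceModel E) (s, p)),
      graphMetric h gN T (s, p) V V = 1 →
        graphTensor n h gN T (s, p) V V ≤
          laplacian (sliceModel E) (graphMetric h gN T)
              (graphLapse N h T) (s, p) / graphLapse N h T (s, p)
            - hessian (sliceModel E) (graphMetric h gN T)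
              (graphLapse N h T) (s, p) V V / graphLapse N h T (s, p)
            + ricci (sliceModel E) (graphMetric h gN T) (s, p) V V) ∧
    ((∀ s ∈ radialInterval r₁ r₂, 0 ≤ graphCoeff h T s - h s ∧
        0 ≤ odi n (fun s' => graphCoeff h T s' - h s') s) →
      ∀ s ∈ radialInterval r₁ r₂, ∀ (p : N) (V : TangentSpace (sliceModel E) (s, p)),
        graphMetric h gN T (s, p) V V = 1 →
          0 ≤ laplacian (sliceModel E) (graphMetric h gN T)
              (graphLapse N h T) (s, p) / graphLapse N h T (s, p)
            - hessian (sliceModel E) (graphMetric h gN T)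
              (graphLapse N h T) (s, p) V V / graphLapse N h T (s, p)
            + ricci (sliceModel E) (graphMetric h gN T) (s, p) V V) := by

  have hn' : (Module.finrank ℝ E : ℝ) = n - 1 := by
    rw [hdim, Nat.cast_sub (by omega), Nat.cast_one]
  have main : ∀ s ∈ radialInterval r₁ r₂, ∀ (p : N) (V : TangentSpace (sliceModel E) (s, p)),
      graphMetric h gN T (s, p) V V = 1 →
        graphTensor n h gN T (s, p) V V ≤
          laplacian (sliceModel E) (graphMetric h gN T)
              (graphLapse N h T) (s, p) / graphLapse N h T (s, p)
            - hessian (sliceModel E) (graphMetric h gN T)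
              (graphLapse N h T) (s, p) V V / graphLapse N h T (s, p)
            + ricci (sliceModel E) (graphMetric h gN T) (s, p) V V := by
    intro s hs p V hV
    have hrs : rH < s := hT.le_left.trans_lt hs.1
    have hφ : ∀ᶠ s' in nhds s, CoeffAt (graphCoeff h T) s' := by
      filter_upwards [(isOpen_radialInterval r₁ r₂).mem_nhds hs] with s' hs'
      exact hT.coeffAt_graphCoeff hh p hs'
    -- After splitting `odi` of the difference, the `h_T` terms and the fibre Ricci terms match,
    -- leaving the null energy inequality for the null lift of the fibre part of `V`.
    rw [hT.substatic_eq hh hn' hs p V hV, graphTensor_apply,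
      odi_sub hφ (hh.eventually_coeffAt hrs)]
    have := hNEC.odi_add_ricci_nonneg hh hn' hrs p (coordVec (sliceModel E) (s, p) V).2
    simp only [sub_mul]
    linarith
  -- It remains to see `B^T(V, V) ≥ 0`: a nonnegative factor times a positive semidefinite form.
  -- Only the differential inequality enters, not the sign of `h_T - h`.
  refine ⟨main, fun hx s hs p V hV => le_trans ?_ (main s hs p V hV)⟩
  rw [graphTensor_apply]
  refine mul_nonneg (hx s hs).2 (mul_nonneg (sq_nonneg s) ?_)
  by_cases he : (coordVec (sliceModel E) (s, p) V).2 = 0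
  · simp [he]
  · exact ((eventually_riemannianAt_chartMetric gN p).self_of_nhds.pos _ he).le
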